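/- Write $\langle k\rangle=\{1,\dots,k\}$ and let $\mathrm{Mat}_{k\times n}$ be the space of real $k\times n$ matrices, where $k\ge 1$, $n\ge 0$. **Definitions.** *Tame functions.* A function $f:\mathbb R^n\to\mathbb C$ is *tame* if it is infinitely differentiable and for each of its partial derivatives $g$ of any order (including $g=f$) there are constants $c_1,c_2$ with $|g(x)|\le c_1e^{c_2\|x\|}$ for all $x\in\mathbb R^n$. For $f_1,\dots,f_k:\mathbb R^n\to\mathbb C$ let $f_1\otimes\cdots\otimes f_k:\mathrm{Mat}_{k\times n}\to\mathbb C$ be the function $x\mapsto\prod_{i=1}^k f_i(x_{i1},\dots,x_{in})$. *Joint cumulants.* For complex random variables $X_1,\dots,X_k$ with absolute moments of all orders, $\kappa(X_1,\dots,X_k)$ is the coefficient of $t_1\cdots t_k$ in the formal power series $$\log\sum_{\nu_1,\dots,\nu_k\ge 0}\mathbf E(X_1^{\nu_1}\cdots X_k^{\nu_k})\,\frac{t_1^{\nu_1}\cdots t_k^{\nu_k}}{\nu_1!\cdots\nu_k!}.$$ *Tree operators.* For a tree $T$ spanning $\langle k\rangle$ and a smooth $f:\mathrm{Mat}_{k\times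 n}\to\mathbb C$, $$L_Tf=\Bigl(\prod_{\{i,i'\}\text{ edge of }T}\ \sum_{j=1}^n D_{ij}D_{i'j}\Bigr)f,$$ where $D_{ij}$ is differentiation with respect to the $(i,j)$ entry. *Weight matrices.* A $k\times k$ *co-ultrametric* is a real symmetric matrix $A$ with $A(i,i)=1$, $A(i,j)\in[0,1]$ and $A(i,l)\ge\min(A(i,j),A(j,l))$ for all $i,j,l$. Its *articulation* is the number of distinct entries of $A$ other than $0$ and $1$; its *co-articulation* is the number of classes of the equivalence relation $i\sim j\Leftrightarrow A(i,j)>0$; $A$ is *gapless* if these two numbers sum to $k$. Let $T$ be a tree spanning $\langle k\rangle$, with edge set $E$, and let $(x_e)_{e\in E}$ be i.i.d. random variables uniformly distributed in $(0,1)$. Then $\mathrm{wt}_T$ is the random matrix that, with probability $1$, is the unique gapless co-ultrametric of articulation $|E|$ with $\mathrm{wt}_T(i,j)=x_{\{i,j\}}$ for every edge $\{i,j\}\in E$. With probability $1$ it is positive definite, and $\sqrt{\mathrm{wt}_T}$ is its positive definite square root. **Theorem.** Let $\zeta\in\mathbb R^n$ and $Z\in\mathrm{Mat}_{k\times n}$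 be random with i.i.d. standard Gaussian entries. Assume that for every tree $T$ spanning $\langle k\rangle$ the random matrix $\mathrm{wt}_T$ is independent of $Z$. Then for any tame functions $f_1,\dots,f_k:\mathbb R^n\to\mathbb C$, the random variables $f_i(\zeta)$ have absolute moments of all orders, the random variables $(L_T(f_1\otimes\cdots\otimes f_k))(\sqrt{\mathrm{wt}_T}\,Z)$ are integrable, and $$\kappa(f_1(\zeta),\dots,f_k(\zeta))=\sum_{T\text{ tree spanning }\langle k\rangle}\mathbf E\,\bigl(L_T(f_1\otimes\cdots\otimes f_k)\bigr)\bigl(\sqrt{\mathrm{wt}_T}\,Z\bigr).$$ -/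

import Mathlib

open MeasureTheory ProbabilityTheory

noncomputable section

namespace TreeCumulant

/-! ### Joint cumulants -/

section Cumulant

variable {Ω : Type*} [MeasurableSpace Ω] {k : ℕ}

/-- The exponential generating series of the joint moments,
`∑_ν E[X₁^ν₁ ⋯ X_k^ν_k] t₁^ν₁ ⋯ t_k^ν_k / (ν₁! ⋯ ν_k!)`. -/
def momentSeries (P : Measure Ω) (X : Fin k → Ω → ℂ) : MvPowerSeries (Fin k) ℂ :=
  fun ν => (∫ ω, ∏ i, X i ω ^ ν i ∂P) / ∏ i, (Nat.factorial (ν i) : ℂ)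

/-- The formal logarithm of the moment series: `log (1 + T)` with `momentSeries P X - 1`
substituted for `T`. The substitution makes sense because, for a probability measure,
the constant term of the moment series is `1`. -/
def cumulantSeries (P : Measure Ω) (X : Fin k → Ω → ℂ) : MvPowerSeries (Fin k) ℂ :=
  (PowerSeries.log ℂ).subst (momentSeries P X - 1)

/-- The joint cumulant `κ(X₁, …, X_k)`: the coefficient of `t₁ ⋯ t_k` in the logarithm of the
moment series. -/
def jointCumulant (P : Measure Ω) (X : Fin k → Ω → ℂ) : ℂ :=
  MvPowerSeries.coeff (Finsupp.equivFunOnFinite.symm fun _ : Fin k => 1) (cumulantSeries P X)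

end Cumulant

/-! ### Tame functions, tensor products and differential operators indexed by trees -/

/-- A function of exponential growth on `ℝⁿ`. -/
def ExpGrowth {n : ℕ} (f : EuclideanSpace ℝ (Fin n) → ℂ) : Prop :=
  ∃ c₁ c₂ : ℝ, ∀ x, ‖f x‖ ≤ c₁ * Real.exp (c₂ * ‖x‖)

/-- Tame functions: smooth, and all partial derivatives `∂_{s 0} ⋯ ∂_{s (m-1)} f`
(`f` itself among them, for `m = 0`) are of exponential growth. -/
structure Tame {n : ℕ} (f : EuclideanSpace ℝ (Fin n) → ℂ) : Prop where
  smooth : ContDiff ℝ (⊤ : ℕ∞) f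
  growth : ∀ (m : ℕ) (s : Fin m → Fin n),
    ExpGrowth fun x => iteratedFDeriv ℝ m f x fun r => EuclideanSpace.single (s r) (1 : ℝ)

section Operators

variable {k n : ℕ}

/-- `f₁ ⊗ ⋯ ⊗ f_k`, the function on `k × n` matrices that applies `f_i` to the `i`-th row and
multiplies the results. -/
def tensorProd (f : Fin k → EuclideanSpace ℝ (Fin n) → ℂ) :
    Matrix (Fin k) (Fin n) ℝ → ℂ :=
  fun x => ∏ i, f i (WithLp.toLp 2 (x i))

/-- `D_{ij}`: differentiation with respect to the entry in position `(i, j)`. -/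
def partialD (i : Fin k) (j : Fin n) (f : Matrix (Fin k) (Fin n) ℝ → ℂ) :
    Matrix (Fin k) (Fin n) ℝ → ℂ :=
  fun x => lineDeriv ℝ f x (Matrix.single i j 1)

/-- The operator `∑_j D_{ij} D_{i'j}` of an edge `e = {i, i'}`, with `i < i'`. -/
def edgeOp (e : Sym2 (Fin k)) (f : Matrix (Fin k) (Fin n) ℝ → ℂ) :
    Matrix (Fin k) (Fin n) ℝ → ℂ :=
  fun x => ∑ j : Fin n, partialD e.inf j (partialD e.sup j f) x

/-- `L_T`: the product of the operators `∑_j D_{ij} D_{i'j}` over the edges `{i, i'}` of `T`,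
that is, these operators applied one after the other. They commute on smooth functions, so
the order in which the edges are listed does not matter there. -/
def treeOp (T : SimpleGraph (Fin k)) (f : Matrix (Fin k) (Fin n) ℝ → ℂ) :
    Matrix (Fin k) (Fin n) ℝ → ℂ :=
  T.edgeSet.toFinite.toFinset.toList.foldr edgeOp f

end Operators

/-! ### Co-ultrametrics and the weight matrix of a forest -/

section CoUltrametric

variable {k : ℕ}

/-- `k × k` co-ultrametrics. -/
structure IsCoUltrametric (A : Matrix (Fin k) (Fin k) ℝ) : Prop where
  symm : A.IsSymm
  diag : ∀ i, A i i = 1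
  mem_Icc : ∀ i j, A i j ∈ Set.Icc (0 : ℝ) 1
  min_le : ∀ i j l, min (A i j) (A j l) ≤ A i l

/-- The number of distinct entries of `A` other than `0` and `1`. -/
def articulation (A : Matrix (Fin k) (Fin k) ℝ) : ℕ :=
  ({a : ℝ | ∃ i j, A i j = a} \ {0, 1}).ncard

/-- The number of classes of the equivalence relation `i ∼ j ↔ A i j > 0`
(an equivalence relation when `A` is a co-ultrametric). -/
def coArticulation (A : Matrix (Fin k) (Fin k) ℝ) : ℕ :=
  (Set.range fun i : Fin k => {j : Fin k | 0 < A i j}).ncard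

/-- Gapless matrices: articulation and co-articulation sum to `k`. -/
def IsGapless (A : Matrix (Fin k) (Fin k) ℝ) : Prop :=
  articulation A + coArticulation A = k

/-- `A` is a gapless co-ultrametric, of articulation the number of edges of `F`, whose entry
at each edge `e` of `F` is the prescribed number `x e`. -/
structure IsWeight (F : SimpleGraph (Fin k)) (x : F.edgeSet → ℝ)
    (A : Matrix (Fin k) (Fin k) ℝ) : Prop where
  coUltrametric : IsCoUltrametric A
  gapless : IsGapless A
  articulation_eq : articulation A = F.edgeSet.ncard
  edge : ∀ (i j : Fin k) (h : F.Adj i j), A i j = x ⟨s(i, j), F.mem_edgeSet.mpr h⟩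

open Classical in
/-- The weight matrix of a forest `F` for edge labels `x`: the unique `A` with `IsWeight F x A`
(and the identity matrix for labels for which there is no such unique `A`). -/
def weightMatrix (F : SimpleGraph (Fin k)) (x : F.edgeSet → ℝ) : Matrix (Fin k) (Fin k) ℝ :=
  if h : ∃! A, IsWeight F x A then h.choose else 1

open scoped MatrixOrder in
/-- The positive semidefinite square root of a positive semidefinite matrix. -/
def matrixSqrt (A : Matrix (Fin k) (Fin k) ℝ) : Matrix (Fin k) (Fin k) ℝ :=
  CFC.sqrt A

end CoUltrametric

/-! ### Random matrices and spanning trees -/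

instance instMeasurableSpaceMatrix (k n : ℕ) : MeasurableSpace (Matrix (Fin k) (Fin n) ℝ) :=
  inferInstanceAs (MeasurableSpace (Fin k → Fin n → ℝ))

/-- The trees spanning `{1, …, k}`. -/
abbrev SpanningTree (k : ℕ) : Type := {T : SimpleGraph (Fin k) // T.IsTree}

instance instFintypeSpanningTree (k : ℕ) : Fintype (SpanningTree k) :=
  Fintype.ofFinite _

end TreeCumulant

end

/-! Both sides are multilinear in $f_1,\dots,f_k$, so it suffices to check the identity on
characters `expo (ξ i)`. On the cumulant side, linearity in the tensor product comes from writing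
each product of moments as a single integral against a law whose rows coincide on blocks
(`blockMeasure`). Fourier inversion then passes from characters to Schwartz functions
(`sum_rowIntegral_schwartz_eq_zero`), and smooth cutoffs with dominated convergence pass to tame
functions (`sum_rowIntegral_tame_eq_zero`).

For characters everything is an explicit Gaussian integral. Put
$u_{ij}=-4\pi^2\langle\xi_i,\xi_j\rangle$ (`gramLabel`). The moment of a block $S$ is
$\exp(\frac12\sum_{i,j\in S}u_{ij})$, the operator $L_T$ multiplies by $\prod_{e\in T}u_e$, and,
given the weight matrix $A$, the expectation over $Z$ is $\exp(\frac12\sum_{i,j}u_{ij}A_{ij})$. The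
diagonal factor $\exp(\frac12\sum_i u_{ii})$ is common to both sides. What remains is the
Brydges–Kennedy identity (`sum_tree_integral_eq_sum_connected`) $$\sum_{G\text{
connected}}\prod_{e\in G}(e^{u_e}-1)=\sum_T\prod_{e\in T}u_e\int\exp\Bigl(\sum_e
u_e\,m_T(x,e)\Bigr)dx,$$ where $m_T(x,e)$ is the least label on the path of $T$ joining the ends of
$e$ (`sepMin`). The left side is the cumulant by the Mayer expansion
(`sum_logCoeff_mul_prod_eq_sum_connected`).

To prove the identity, write $e^u-1=\int_0^1ue^{ut}\,dt$, which puts uniform labels on all edges,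
and sort the connected graphs by their maximal spanning tree $T$. An edge outside $T$ may be present
exactly when its label is below $m=m_T(x,e)$, so it contributes $1+\int_0^m ue^{ut}\,dt=e^{um}$.
Finally, `weightMatrix_eq` identifies the path minima with the gapless co-ultrametric of the
theorem. -/

namespace TreeCumulant

/-! ### Surjection numbers and the coefficients of the logarithm. -/

section SurjectionCount

/-- The number of surjections from an `r`-element set onto a `d`-element set. -/
noncomputable def surjCount (r d : ℕ) : ℕ := Nat.card {p : Fin r → Fin d // Function.Surjective p}

lemma card_surjective_eq_surjCount (C : Type*) [Fintype C] (d : ℕ) :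
    Nat.card {p : C → Fin d // Function.Surjective p} = surjCount (Fintype.card C) d := by
  refine Nat.card_congr (Equiv.subtypeEquiv (Equiv.arrowCongr (Fintype.equivFin C) (Equiv.refl _)) ?_)
  intro p
  simp [Equiv.arrowCongr, Function.comp_def]
  constructor
  · intro h b
    obtain ⟨a, rfl⟩ := h b
    exact ⟨Fintype.equivFin C a, by simp⟩
  · intro h b
    obtain ⟨a, rfl⟩ := h b
    exact ⟨_, rfl⟩

lemma surjCount_eq_zero_of_lt {r d : ℕ} (h : r < d) : surjCount r d = 0 := by
  have : IsEmpty {p : Fin r → Fin d // Function.Surjective p} :=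
    ⟨fun p => by
      have := Fintype.card_le_of_surjective p.1 p.2
      simp at this; omega⟩
  simp [surjCount]

lemma surjCount_succ_zero (r : ℕ) : surjCount (r + 1) 0 = 0 := by
  have : IsEmpty {p : Fin (r + 1) → Fin 0 // Function.Surjective p} := ⟨fun p => (p.1 0).elim0⟩
  simp [surjCount]

lemma surjCount_zero_zero : surjCount 0 0 = 1 := by
  unfold surjCount
  rw [Nat.card_eq_one_iff_unique]
  exact ⟨⟨fun a b => Subtype.ext (Subsingleton.elim _ _)⟩, ⟨⟨Fin.elim0, fun b => b.elim0⟩⟩⟩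

lemma surjective_cons_iff {r d : ℕ} (a : Fin (d + 1)) (q : Fin r → Fin (d + 1)) :
    Function.Surjective (Fin.cons a q : Fin (r + 1) → Fin (d + 1)) ↔
      ∀ b, b ≠ a → ∃ i, q i = b := by
  constructor
  · intro h b hb
    obtain ⟨i, hi⟩ := h b
    refine Fin.cases (fun hi => ?_) (fun i hi => ?_) i hi
    · exact absurd hi.symm (by simpa using hb)
    · exact ⟨i, by simpa using hi⟩
  · intro h b
    by_cases hb : b = a
    · exact ⟨0, by simp [hb]⟩
    · obtain ⟨i, hi⟩ := h b hb
      exact ⟨i.succ, by simpa using hi⟩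

/-- Either `q` also hits `a` and is surjective, or it misses `a` and factors through `a.succAbove`
as a surjection onto `d` points. -/
lemma card_surjective_cons (r d : ℕ) (a : Fin (d + 1)) :
    Nat.card {q : Fin r → Fin (d + 1) // ∀ b, b ≠ a → ∃ i, q i = b} =
      surjCount r (d + 1) + surjCount r d := by
  classical
  let F : {q : Fin r → Fin (d + 1) // Function.Surjective q} ⊕
      {q : Fin r → Fin d // Function.Surjective q} →
      {q : Fin r → Fin (d + 1) // ∀ b, b ≠ a → ∃ i, q i = b} :=
    Sum.elim (fun q => ⟨q.1, fun b _ => q.2 b⟩)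
      (fun q => ⟨fun i => a.succAbove (q.1 i), fun b hb => by
        obtain ⟨c, rfl⟩ := Fin.exists_succAbove_eq hb
        obtain ⟨i, rfl⟩ := q.2 c
        exact ⟨i, rfl⟩⟩)
  have hF : Function.Bijective F := by
    constructor
    · rintro (⟨q, hq⟩ | ⟨q, hq⟩) (⟨q', hq'⟩ | ⟨q', hq'⟩) h
      · simpa [F] using h
      · obtain ⟨i, hi⟩ := hq a
        have := congrFun (congrArg Subtype.val h) i
        simp [F, hi] at this
      · obtain ⟨i, hi⟩ := hq' a
        have := congrFun (congrArg Subtype.val h) i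
        simp [F, hi] at this
      · have : ∀ i, q i = q' i := fun i => by
          have := congrFun (congrArg Subtype.val h) i
          exact Fin.succAbove_right_injective this
        simp [funext this]
    · rintro ⟨q, hq⟩
      by_cases h : ∃ i, q i = a
      · exact ⟨Sum.inl ⟨q, fun b => by by_cases hb : b = a; exacts [hb ▸ h, hq b hb]⟩, rfl⟩
      · push Not at h
        choose c hc using fun i => Fin.exists_succAbove_eq (h i)
        refine ⟨Sum.inr ⟨c, fun b => ?_⟩, Subtype.ext (funext hc)⟩
        obtain ⟨i, hi⟩ := hq _ (Fin.succAbove_ne a b)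
        exact ⟨i, Fin.succAbove_right_injective ((hc i).trans hi)⟩
  rw [← Nat.card_eq_of_bijective F hF, Nat.card_sum]; rfl

lemma surjCount_succ_succ (r d : ℕ) :
    surjCount (r + 1) (d + 1) = (d + 1) * (surjCount r (d + 1) + surjCount r d) := by
  have e : {p : Fin (r + 1) → Fin (d + 1) // Function.Surjective p} ≃
      Σ a : Fin (d + 1), {q : Fin r → Fin (d + 1) // ∀ b, b ≠ a → ∃ i, q i = b} :=
    { toFun := fun p => ⟨p.1 0, Fin.tail p.1, (surjective_cons_iff _ _).1 (by
        rw [Fin.cons_self_tail]; exact p.2)⟩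
      invFun := fun s => ⟨Fin.cons s.1 s.2.1, (surjective_cons_iff _ _).2 s.2.2⟩
      left_inv := fun p => Subtype.ext (Fin.cons_self_tail p.1)
      right_inv := fun s => by
        rcases s with ⟨a, q, hq⟩
        exact Sigma.ext rfl (heq_of_eq (Subtype.ext (Fin.tail_cons (α := fun _ => Fin (d + 1)) a q))) }
  rw [surjCount, Nat.card_congr e, Nat.card_sigma]
  simp only [card_surjective_cons]
  simp

/-- The coefficients of `log (1 + T)`. -/
noncomputable def logCoeff (d : ℕ) : ℂ := if d = 0 then 0 else (-1) ^ (d + 1) / d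

/-- This is $\log(1+(e^t-1))=t$ read off coefficientwise, as $(e^t-1)^d$ is the exponential
generating function of surjections onto $d$ points. The recurrence for `surjCount` makes the sum
telescope; the upper end vanishes because `r - 1 < N`. -/
lemma sum_logCoeff_mul_surjCount {r N : ℕ} (hr : 1 ≤ r) (hN : r ≤ N) :
    ∑ d ∈ Finset.range (N + 1), logCoeff d * surjCount r d = if r = 1 then 1 else 0 := by
  obtain ⟨s, rfl⟩ : ∃ s, r = s + 1 := ⟨r - 1, by omega⟩
  have h1 : ∀ d, logCoeff (d + 1) * surjCount (s + 1) (d + 1) =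
      (-1) ^ d * surjCount s d - (-1) ^ (d + 1) * surjCount s (d + 1) := by
    intro d
    have : (d : ℂ) + 1 ≠ 0 := by exact_mod_cast d.succ_ne_zero
    rw [surjCount_succ_succ, logCoeff, if_neg d.succ_ne_zero]
    push_cast
    field_simp
    ring
  rw [Finset.sum_range_succ', surjCount_succ_zero]
  simp only [h1]
  rw [Finset.sum_range_sub', surjCount_eq_zero_of_lt (show s < N by omega)]
  rcases s with _ | s
  · simp [surjCount_zero_zero]
  · simp [surjCount_succ_zero]

end SurjectionCount

/-! ### Mayer expansion: the logarithm keeps the connected graphs. -/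

section GraphExpansion

open Classical in
/-- The edges of the complete graph. -/
noncomputable def nonDiag (V : Type*) [Fintype V] : Finset (Sym2 V) :=
  Finset.univ.filter fun e => ¬ e.IsDiag

lemma mem_nonDiag {V : Type*} [Fintype V] {e : Sym2 V} : e ∈ nonDiag V ↔ ¬ e.IsDiag := by
  simp [nonDiag]

variable {V : Type*} [Fintype V]

open Classical in
lemma prod_nonDiag_add (f g : Sym2 V → ℂ) :
    ∏ e ∈ nonDiag V, (f e + g e) =
      ∑ G : SimpleGraph V, ∏ e ∈ nonDiag V, if e ∈ G.edgeSet then f e else g e := by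
  rw [Finset.prod_add]
  refine Finset.sum_bij' (fun t _ => SimpleGraph.fromEdgeSet (t : Set (Sym2 V)))
    (fun G _ => G.edgeFinset) (by simp) ?_ ?_ ?_ ?_
  · intro G _
    rw [Finset.mem_powerset]
    intro e he
    exact mem_nonDiag.2 (G.not_isDiag_of_mem_edgeFinset he)
  · intro t ht
    ext e
    rw [Finset.mem_powerset] at ht
    simp only [SimpleGraph.mem_edgeFinset, SimpleGraph.edgeSet_fromEdgeSet, Set.mem_sdiff,
      Finset.mem_coe]
    exact ⟨fun h => h.1, fun h => ⟨h, mem_nonDiag.1 (ht h)⟩⟩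
  · intro G _
    simp
  · intro t ht
    rw [Finset.mem_powerset] at ht
    refine Eq.trans ?_ ((Finset.prod_ite (s := nonDiag V)
      (p := fun e => e ∈ (SimpleGraph.fromEdgeSet (t : Set (Sym2 V))).edgeSet) f g).symm.trans
      (Finset.prod_congr rfl fun e _ => by congr))
    have h1 : {e ∈ nonDiag V | e ∈ (SimpleGraph.fromEdgeSet (t : Set (Sym2 V))).edgeSet} = t := by
      ext e
      simp only [Finset.mem_filter, SimpleGraph.edgeSet_fromEdgeSet, Set.mem_sdiff,
        Finset.mem_coe]
      exact ⟨fun h => h.2.1, fun h => ⟨ht h, h, mem_nonDiag.1 (ht h)⟩⟩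
    have h2 : {e ∈ nonDiag V | e ∉ (SimpleGraph.fromEdgeSet (t : Set (Sym2 V))).edgeSet} =
        nonDiag V \ t := by
      ext e
      simp only [Finset.mem_filter, SimpleGraph.edgeSet_fromEdgeSet, Set.mem_sdiff,
        Finset.mem_coe, Finset.mem_sdiff]
      exact ⟨fun h => ⟨h.1, fun h' => h.2 ⟨h', mem_nonDiag.1 h.1⟩⟩, fun h => ⟨h.1, fun h' => h.2 h'.1⟩⟩
    rw [h1, h2]

open Classical in
/-- The weight of a graph, the product of the labels of its edges. -/
noncomputable def edgeProd (v : Sym2 V → ℂ) (G : SimpleGraph V) : ℂ :=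
  ∏ e ∈ G.edgeFinset, v e

open Classical in
lemma edgeProd_eq (v : Sym2 V → ℂ) (G : SimpleGraph V) :
    edgeProd v G = ∏ e ∈ nonDiag V, if e ∈ G.edgeSet then v e else 1 := by
  rw [← Finset.prod_filter]
  refine Finset.prod_congr ?_ fun _ _ => rfl
  ext e
  simp only [SimpleGraph.mem_edgeFinset, Finset.mem_filter, mem_nonDiag]
  exact ⟨fun h => ⟨G.not_isDiag_of_mem_edgeSet h, h⟩, fun h => h.2⟩

/-- Maps that are constant along the edges of `G` are maps on the components of `G`. -/
noncomputable def componentMapEquiv (G : SimpleGraph V) (D : Type*) :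
    {p : {p : V → D // Function.Surjective p} // ∀ i j, G.Adj i j → p.1 i = p.1 j} ≃
      {q : G.ConnectedComponent → D // Function.Surjective q} where
  toFun p := ⟨SimpleGraph.ConnectedComponent.lift p.1.1 (fun i j w _ => by
      clear * - w
      induction w with
      | nil => rfl
      | cons h _ ih => exact (p.2 _ _ h).trans ih), fun b => by
    obtain ⟨i, hi⟩ := p.1.2 b
    exact ⟨G.connectedComponentMk i, by simpa using hi⟩⟩
  invFun q := ⟨⟨fun i => q.1 (G.connectedComponentMk i), fun b => by
    obtain ⟨c, hc⟩ := q.2 b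
    obtain ⟨i, rfl⟩ := c.exists_rep
    exact ⟨i, hc⟩⟩, fun i j h => congrArg q.1 (SimpleGraph.ConnectedComponent.sound h.reachable)⟩
  left_inv p := rfl
  right_inv q := by
    refine Subtype.ext (funext fun c => ?_)
    obtain ⟨i, rfl⟩ := c.exists_rep
    rfl

open Classical in
lemma card_connectedComponent_eq_one_iff [Nonempty V] (G : SimpleGraph V) :
    Fintype.card G.ConnectedComponent = 1 ↔ G.Connected := by
  rw [Fintype.card_eq_one_iff_nonempty_unique]
  constructor
  · rintro ⟨h⟩
    refine ⟨fun i j => ?_⟩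
    exact SimpleGraph.ConnectedComponent.exact (Subsingleton.elim _ _)
  · intro h
    have := h.preconnected.subsingleton_connectedComponent
    exact ⟨⟨⟨G.connectedComponentMk (Classical.arbitrary V)⟩, fun a => Subsingleton.elim _ _⟩⟩

open Classical in
/-- The multilinear logarithm of a graph expansion is the expansion over connected graphs. -/
theorem sum_logCoeff_mul_prod_eq_sum_connected [Nonempty V] (v : Sym2 V → ℂ) :
    ∑ d ∈ Finset.range (Fintype.card V + 1), logCoeff d *
      ∑ p : {p : V → Fin d // Function.Surjective p},
        ∏ e ∈ nonDiag V, (if (e.map p.1).IsDiag then 1 + v e else 1) =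
      ∑ G : SimpleGraph V, if G.Connected then edgeProd v G else 0 := by
  -- Expanding `1 + v e` over the pairs inside fibres of `p` leaves the graphs along whose edges `p`
  -- is constant.
  have h1 : ∀ (d : ℕ) (p : V → Fin d), ∏ e ∈ nonDiag V, (if (e.map p).IsDiag then 1 + v e else 1) =
      ∑ G : SimpleGraph V, if (∀ i j, G.Adj i j → p i = p j) then edgeProd v G else 0 := by
    intro d p
    have : ∀ e, (if (e.map p).IsDiag then 1 + v e else 1) =
        (if (e.map p).IsDiag then v e else 0) + 1 := by
      intro e; split_ifs <;> ring
    simp only [this]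
    rw [prod_nonDiag_add]
    refine Finset.sum_congr rfl fun G _ => ?_
    split_ifs with h
    · rw [edgeProd_eq]
      refine Finset.prod_congr rfl fun e _ => ?_
      by_cases he : e ∈ G.edgeSet
      · rw [if_pos he, if_pos he, if_pos]
        induction e with
        | _ i j => simpa using h i j he
      · rw [if_neg he, if_neg he]
    · push Not at h
      obtain ⟨i, j, hij, hp⟩ := h
      refine Finset.prod_eq_zero (i := s(i, j)) (mem_nonDiag.2 (by simpa using hij.ne)) ?_
      simp [hij, hp]
  simp only [h1]
  -- For fixed `G` the admissible `p` are the surjections from the set of components of `G`; summed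
  -- against `logCoeff`, their number leaves only the graphs with one component.
  have h2 : ∀ d, ∑ p : {p : V → Fin d // Function.Surjective p},
      (∑ G : SimpleGraph V, if (∀ i j, G.Adj i j → p.1 i = p.1 j) then edgeProd v G else 0) =
      ∑ G : SimpleGraph V, (surjCount (Fintype.card G.ConnectedComponent) d : ℂ) * edgeProd v G := by
    intro d
    rw [Finset.sum_comm]
    refine Finset.sum_congr rfl fun G _ => ?_
    rw [← Finset.sum_filter, Finset.sum_const, nsmul_eq_mul, ← card_surjective_eq_surjCount,
      ← Nat.card_congr (componentMapEquiv G (Fin d)), Nat.card_eq_fintype_card, Fintype.card_subtype]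
  simp only [h2, Finset.mul_sum]
  rw [Finset.sum_comm]
  refine Finset.sum_congr rfl fun G _ => ?_
  simp only [← mul_assoc]
  rw [← Finset.sum_mul, sum_logCoeff_mul_surjCount Fintype.card_pos
    (Fintype.card_le_of_surjective G.connectedComponentMk Quot.mk_surjective)]
  simp only [card_connectedComponent_eq_one_iff]
  split_ifs <;> simp

end GraphExpansion

end TreeCumulant

namespace TreeCumulant

/-! ### Maximal spanning trees for distinct edge labels. -/

section MaximalSpanningTree

variable {V : Type*}

/-- The subgraph of the edges with label greater than `t`. -/
def above (G : SimpleGraph V) (y : Sym2 V → ℝ) (t : ℝ) : SimpleGraph V where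
  Adj i j := G.Adj i j ∧ t < y s(i, j)
  symm := ⟨fun i j h => ⟨h.1.symm, by rw [Sym2.eq_swap]; exact h.2⟩⟩
  loopless := ⟨fun i h => G.loopless.irrefl i h.1⟩

lemma reachable_of_forall_adj {G H : SimpleGraph V} (h : ∀ i j, G.Adj i j → H.Reachable i j)
    {i j : V} (hij : G.Reachable i j) : H.Reachable i j := by
  obtain ⟨w⟩ := hij
  induction w with
  | nil => rfl
  | cons h' _ ih => exact (h _ _ h').trans ih

lemma above_mono_left {G H : SimpleGraph V} (h : G ≤ H) (y : Sym2 V → ℝ) (t : ℝ) :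
    above G y t ≤ above H y t := fun _ _ hij => ⟨h hij.1, hij.2⟩

lemma above_anti (G : SimpleGraph V) (y : Sym2 V → ℝ) {s t : ℝ} (h : s ≤ t) :
    above G y t ≤ above G y s := fun _ _ hij => ⟨hij.1, h.trans_lt hij.2⟩

/-- The edges of `G` whose ends are not joined by edges of `G` with greater labels. -/
def maxSpan (G : SimpleGraph V) (y : Sym2 V → ℝ) : SimpleGraph V where
  Adj i j := G.Adj i j ∧ ¬ (above G y (y s(i, j))).Reachable i j
  symm := ⟨fun i j h => ⟨h.1.symm, fun h' => h.2 (by rw [Sym2.eq_swap]; exact h'.symm)⟩⟩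
  loopless := ⟨fun i h => G.loopless.irrefl i h.1⟩

lemma maxSpan_le (G : SimpleGraph V) (y : Sym2 V → ℝ) : maxSpan G y ≤ G := fun _ _ h => h.1

/-- Induction from the greatest label downwards: an edge that was not selected has its ends joined
by edges of greater label, each of which has already been replaced by a walk of selected edges. -/
lemma reachable_above_maxSpan [Finite V] (G : SimpleGraph V) (y : Sym2 V → ℝ) (t : ℝ) {i j : V}
    (h : (above G y t).Reachable i j) : (above (maxSpan G y) y t).Reachable i j := by
  have key : ∀ e : Sym2 V, ∀ i j, e = s(i, j) → (above G y t).Adj i j →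
      (above (maxSpan G y) y t).Reachable i j := by
    have wf : WellFounded fun e f : Sym2 V => y f < y e :=
      @Finite.wellFounded_of_trans_of_irrefl _ _ _ ⟨fun _ _ _ h h' => h'.trans h⟩
        ⟨fun _ => lt_irrefl _⟩
    intro e
    induction e using wf.induction with
    | _ e ih =>
      rintro i j rfl hij
      by_cases hM : (above G y (y s(i, j))).Reachable i j
      · exact reachable_of_forall_adj (G := above G y (y s(i, j))) (fun a b hab =>
          ih _ hab.2 a b rfl ⟨hab.1, hij.2.trans hab.2⟩) hM
      · exact SimpleGraph.Adj.reachable ⟨⟨hij.1, hM⟩, hij.2⟩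
  exact reachable_of_forall_adj (fun a b hab => key _ a b rfl hab) h

/-- The edge of least label on a cycle is bypassed by the rest of the cycle, whose labels are
strictly greater by injectivity, so it is not selected. -/
lemma maxSpan_isAcyclic (G : SimpleGraph V) {y : Sym2 V → ℝ} (hy : Function.Injective y) :
    (maxSpan G y).IsAcyclic := by
  classical
  intro v c hc
  obtain ⟨f, hf, hmin⟩ := c.edges.toFinset.exists_min_image y (by
    rw [List.toFinset_nonempty_iff]
    intro h
    have h0 := congrArg List.length h
    have := hc.three_le_length
    rw [SimpleGraph.Walk.length_edges, List.length_nil] at h0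
    omega)
  rw [List.mem_toFinset] at hf
  induction f with
  | _ i j =>
    have hadj : (maxSpan G y).Adj i j := c.adj_of_mem_edges hf
    let H : SimpleGraph V := SimpleGraph.fromEdgeSet {e | e ∈ c.edges}
    have hH : ∀ e ∈ c.edges, e ∈ H.edgeSet := fun e he => by
      rw [SimpleGraph.edgeSet_fromEdgeSet]
      exact ⟨he, (maxSpan G y).not_isDiag_of_mem_edgeSet (c.edges_subset_edgeSet he)⟩
    have := (SimpleGraph.adj_and_reachable_delete_edges_iff_exists_cycle (G := H)
      (v := i) (w := j)).2 ⟨v, c.transfer H hH, hc.transfer hH, by simpa using hf⟩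
    refine hadj.2 (this.2.mono fun a b hab => ?_)
    have hab' : s(a, b) ∈ c.edges ∧ s(a, b) ≠ s(i, j) := by
      rw [SimpleGraph.deleteEdges_adj] at hab
      exact ⟨((SimpleGraph.fromEdgeSet_adj _).1 hab.1).1, hab.2⟩
    refine ⟨(c.adj_of_mem_edges hab'.1).1, lt_of_le_of_ne (hmin _ (List.mem_toFinset.2 hab'.1)) ?_⟩
    exact fun h => hab'.2 (hy h.symm)

lemma exists_above_eq [Finite V] (G : SimpleGraph V) (y : Sym2 V → ℝ) : ∃ t, above G y t = G := by
  obtain ⟨t, ht⟩ := (Set.finite_range y).bddBelow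
  refine ⟨t - 1, ?_⟩
  ext i j
  exact ⟨fun h => h.1, fun h => ⟨h, (sub_one_lt t).trans_le (ht ⟨_, rfl⟩)⟩⟩

lemma maxSpan_isTree [Finite V] {G : SimpleGraph V} (hG : G.Connected) {y : Sym2 V → ℝ}
    (hy : Function.Injective y) : (maxSpan G y).IsTree := by
  have := hG.nonempty
  refine ⟨⟨fun i j => ?_⟩, maxSpan_isAcyclic G hy⟩
  obtain ⟨t, ht⟩ := exists_above_eq G y
  refine (reachable_above_maxSpan G y t ?_).mono (G := above (maxSpan G y) y t) fun _ _ h => h.1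
  rw [ht]
  exact hG.preconnected i j

lemma not_reachable_deleteEdges {T : SimpleGraph V} (hT : T.IsAcyclic) {i j : V} (h : T.Adj i j) :
    ¬ (T.deleteEdges {s(i, j)}).Reachable i j := by
  have := SimpleGraph.isBridge_iff.1 (SimpleGraph.isAcyclic_iff_forall_isBridge.1 hT h)
  simpa using this

/-- By `h`, `G` and `T` have the same connectivity above every threshold. An edge of `T` bypassed in
`G` by greater labels would then be bypassed within `T`, against acyclicity. -/
lemma eq_maxSpan {G T : SimpleGraph V} {y : Sym2 V → ℝ} (hT : T.IsAcyclic) (hTG : T ≤ G)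
    (h : ∀ i j, G.Adj i j → ¬ T.Adj i j → (above T y (y s(i, j))).Reachable i j) :
    T = maxSpan G y := by
  have h1 : ∀ t i j, (above G y t).Reachable i j → (above T y t).Reachable i j := by
    intro t i j hij
    refine reachable_of_forall_adj (fun a b hab => ?_) hij
    by_cases hT' : T.Adj a b
    · exact SimpleGraph.Adj.reachable ⟨hT', hab.2⟩
    · exact (h a b hab.1 hT').mono (above_anti T y hab.2.le)
  ext i j
  constructor
  · intro hij
    refine ⟨hTG hij, fun h' => not_reachable_deleteEdges hT hij ((h1 _ _ _ h').mono ?_)⟩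
    intro a b hab
    rw [SimpleGraph.deleteEdges_adj]
    refine ⟨hab.1, fun h => ?_⟩
    rw [Set.mem_singleton_iff] at h
    exact absurd hab.2 (by rw [h]; exact lt_irrefl _)
  · intro hij
    by_contra hT'
    exact hij.2 ((h i j hij.1 hT').mono (above_mono_left hTG y _))

open Classical in
/-- The edges of `T` whose removal disconnects the ends of `e`. -/
noncomputable def sepEdges [Fintype V] (T : SimpleGraph V) (e : Sym2 V) : Finset (Sym2 V) :=
  T.edgeFinset.filter fun f => ∀ i j, e = s(i, j) → ¬ (T.deleteEdges {f}).Reachable i j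

variable [Fintype V]

lemma mem_sepEdges {T : SimpleGraph V} {f : Sym2 V} {i j : V} :
    f ∈ sepEdges T s(i, j) ↔ f ∈ T.edgeSet ∧ ¬ (T.deleteEdges {f}).Reachable i j := by
  classical
  simp only [sepEdges, Finset.mem_filter, SimpleGraph.mem_edgeFinset]
  refine and_congr_right fun _ => ⟨fun h => h i j rfl, fun h a b hab => ?_⟩
  rcases Sym2.eq_iff.1 hab with ⟨rfl, rfl⟩ | ⟨rfl, rfl⟩
  · exact h
  · exact fun h' => h h'.symm

lemma mem_edgeSet_of_mem_sepEdges {T : SimpleGraph V} {e f : Sym2 V} (h : f ∈ sepEdges T e) :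
    f ∈ T.edgeSet := by
  induction e with
  | _ i j => exact (mem_sepEdges.1 h).1

/-- The separating edges are those of the unique path from `i` to `j`: if the ends stayed joined
without some edge of that path, there would be a second path. -/
lemma reachable_above_iff {T : SimpleGraph V} (hT : T.IsTree) (y : Sym2 V → ℝ) (t : ℝ) (i j : V) :
    (above T y t).Reachable i j ↔ ∀ f ∈ sepEdges T s(i, j), t < y f := by
  classical
  constructor
  · intro h f hf
    rw [mem_sepEdges] at hf
    by_contra hft
    refine hf.2 (h.mono fun a b hab => ?_)
    rw [SimpleGraph.deleteEdges_adj]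
    refine ⟨hab.1, fun h' => hft ?_⟩
    rw [Set.mem_singleton_iff] at h'
    exact h' ▸ hab.2
  · intro h
    obtain ⟨p, hp⟩ := (hT.1.preconnected i j).exists_isPath
    have hH : ∀ e ∈ p.edges, e ∈ (above T y t).edgeSet := by
      intro e he
      have heT := p.edges_subset_edgeSet he
      have hsep : e ∈ sepEdges T s(i, j) := by
        refine mem_sepEdges.2 ⟨heT, fun hr => ?_⟩
        obtain ⟨q, hq⟩ := hr.exists_isPath
        have hq' := (hT.2.subsingleton_path i j).elim ⟨p, hp⟩
          ⟨q.mapLe (SimpleGraph.deleteEdges_le _), hq.mapLe (SimpleGraph.deleteEdges_le _)⟩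
        have : e ∈ q.edges := by
          have h1 : p = q.mapLe (SimpleGraph.deleteEdges_le _) := congrArg Subtype.val hq'
          rw [h1] at he
          simpa using he
        have := q.edges_subset_edgeSet this
        simp at this
      have := h e hsep
      induction e with
      | _ a b => exact ⟨heT, this⟩
    exact ⟨p.transfer _ hH⟩

/-- The least label of an edge separating the ends of `e`, and `1` if there is none. -/
noncomputable def sepMin (T : SimpleGraph V) (y : Sym2 V → ℝ) (e : Sym2 V) : ℝ :=
  (sepEdges T e).fold min 1 y

lemma lt_sepMin_iff {T : SimpleGraph V} {y : Sym2 V → ℝ} {e : Sym2 V} {t : ℝ} :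
    t < sepMin T y e ↔ t < 1 ∧ ∀ f ∈ sepEdges T e, t < y f := Finset.lt_fold_min t

lemma sepMin_le_one (T : SimpleGraph V) (y : Sym2 V → ℝ) (e : Sym2 V) : sepMin T y e ≤ 1 :=
  not_lt.1 fun h => lt_irrefl _ (lt_sepMin_iff.1 h).1

lemma sepMin_congr {T : SimpleGraph V} {y z : Sym2 V → ℝ} (h : ∀ e ∈ T.edgeSet, y e = z e)
    (e : Sym2 V) : sepMin T y e = sepMin T z e :=
  Finset.fold_congr fun f hf => h f (mem_edgeSet_of_mem_sepEdges hf)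

lemma sepEdges_of_mem {T : SimpleGraph V} (hT : T.IsAcyclic) {e : Sym2 V} (he : e ∈ T.edgeSet) :
    sepEdges T e = {e} := by
  induction e with
  | _ i j =>
    ext f
    rw [mem_sepEdges, Finset.mem_singleton]
    constructor
    · rintro ⟨_, h⟩
      by_contra hf
      refine h (SimpleGraph.Adj.reachable ?_)
      rw [SimpleGraph.deleteEdges_adj]
      exact ⟨he, fun h' => hf (Set.mem_singleton_iff.1 h').symm⟩
    · rintro rfl
      exact ⟨he, not_reachable_deleteEdges hT he⟩

lemma sepMin_of_mem {T : SimpleGraph V} (hT : T.IsAcyclic) {y : Sym2 V → ℝ} {e : Sym2 V}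
    (he : e ∈ T.edgeSet) (hy : y e ≤ 1) : sepMin T y e = y e := by
  rw [sepMin, sepEdges_of_mem hT he, Finset.fold_singleton, min_eq_left hy]

lemma measurable_sepMin (T : SimpleGraph V) (e : Sym2 V) :
    Measurable fun y : Sym2 V → ℝ => sepMin T y e := by
  unfold sepMin
  induction sepEdges T e using Finset.cons_induction with
  | empty => simp
  | cons a s ha ih =>
    simp only [Finset.fold_cons]
    exact (measurable_pi_apply a).min ih

/-- `T` is contained in `G`, and each further edge of `G` has a smaller label than each edge of `T`
separating its ends. -/
def IsMaxSpan (G T : SimpleGraph V) (y : Sym2 V → ℝ) : Prop :=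
  T ≤ G ∧ ∀ e ∈ G.edgeSet, e ∉ T.edgeSet → ∀ f ∈ sepEdges T e, y e < y f

lemma isMaxSpan_maxSpan {G : SimpleGraph V} (hG : G.Connected) {y : Sym2 V → ℝ}
    (hy : Function.Injective y) : IsMaxSpan G (maxSpan G y) y := by
  refine ⟨maxSpan_le G y, fun e he heT => ?_⟩
  induction e with
  | _ i j =>
    rw [← reachable_above_iff (maxSpan_isTree hG hy)]
    apply reachable_above_maxSpan
    by_contra h
    exact heT ⟨he, h⟩

/-- This trades a sum over connected graphs for a sum over trees `T` and graphs `G` having `T` as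
maximal spanning tree, a condition that can be tested edge by edge. -/
lemma isTree_and_isMaxSpan_iff {G : SimpleGraph V} {y : Sym2 V → ℝ} (hy : Function.Injective y)
    (T : SimpleGraph V) :
    (T.IsTree ∧ IsMaxSpan G T y) ↔ (G.Connected ∧ T = maxSpan G y) := by
  constructor
  · rintro ⟨hT, hTG, h⟩
    refine ⟨hT.1.mono hTG, eq_maxSpan hT.2 hTG fun i j hij hT' => ?_⟩
    rw [reachable_above_iff hT]
    exact h _ hij hT'
  · rintro ⟨hG, rfl⟩
    exact ⟨maxSpan_isTree hG hy, isMaxSpan_maxSpan hG hy⟩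

lemma measurableSet_isMaxSpan (G T : SimpleGraph V) :
    MeasurableSet {y : Sym2 V → ℝ | IsMaxSpan G T y} := by
  have : {y : Sym2 V → ℝ | IsMaxSpan G T y} = {y | T ≤ G} ∩ ⋂ e ∈ {e | e ∈ G.edgeSet ∧ e ∉ T.edgeSet},
      ⋂ f ∈ sepEdges T e, {y | y e < y f} := by
    ext y
    simp [IsMaxSpan]
  rw [this]
  refine (MeasurableSet.const _).inter ?_
  refine MeasurableSet.biInter (Set.to_countable _) fun e _ => ?_
  refine Finset.measurableSet_biInter _ fun f _ => ?_
  exact measurableSet_lt (measurable_pi_apply e) (measurable_pi_apply f)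

end MaximalSpanningTree

end TreeCumulant

namespace TreeCumulant

/-! ### The Brydges–Kennedy identity. -/

section TreeIntegral

/-- The uniform distribution on the unit interval. -/
noncomputable abbrev unif : Measure ℝ := volume.restrict (Set.Ioo (0 : ℝ) 1)

instance instIsProbabilityMeasureUnif : IsProbabilityMeasure unif := ⟨by simp⟩

open Classical in
/-- Extension by zero. -/
noncomputable def extendZero {ι : Type*} {S : Set ι} (p : S → ℝ) (i : ι) : ℝ :=
  if h : i ∈ S then p ⟨i, h⟩ else 0

lemma extendZero_of_mem {ι : Type*} {S : Set ι} (p : S → ℝ) {i : ι} (h : i ∈ S) :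
    extendZero p i = p ⟨i, h⟩ := dif_pos h

-- Fubini with the coordinates in `S` outermost: once these are fixed, the other factors involve one
-- coordinate each and integrate separately.
open Classical in
lemma integral_pi_split {ι : Type*} [Fintype ι] (ν : Measure ℝ) [IsProbabilityMeasure ν]
    (S : Set ι) [hS : Fintype S] (g : ι → (S → ℝ) → ℝ → ℂ)
    (hint : Integrable (fun y : ι → ℝ => ∏ i, g i (fun s => y s) (y i)) (Measure.pi fun _ => ν)) :
    ∫ y : ι → ℝ, ∏ i, g i (fun s => y s) (y i) ∂(Measure.pi fun _ => ν) =
      ∫ p : S → ℝ, ∏ i, (if h : i ∈ S then g i p (p ⟨i, h⟩) else ∫ t, g i p t ∂ν)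
        ∂(Measure.pi fun _ => ν) := by
  obtain rfl : hS = Subtype.fintype (· ∈ S) := Subsingleton.elim _ _
  have hmp := measurePreserving_piEquivPiSubtypeProd (fun _ : ι => ν) (· ∈ S)
  have hmp' := hmp.symm
  rw [← hmp'.integral_comp', integral_prod]
  · refine integral_congr_ae (Filter.Eventually.of_forall fun p => ?_)
    have h1 : ∀ q : {i // i ∉ S} → ℝ,
        ∏ i, g i (fun s => (MeasurableEquiv.piEquivPiSubtypeProd (fun _ => ℝ) (· ∈ S)).symm (p, q) s)
          ((MeasurableEquiv.piEquivPiSubtypeProd (fun _ => ℝ) (· ∈ S)).symm (p, q) i) =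
        (∏ i : {i // i ∈ S}, g i p (p i)) * ∏ i : {i // i ∉ S}, g i p (q i) := by
      intro q
      rw [← Fintype.prod_subtype_mul_prod_subtype (· ∈ S)]
      congr 1
      · refine Finset.prod_congr rfl fun i _ => ?_
        congr 1
        · ext s
          simp [MeasurableEquiv.piEquivPiSubtypeProd, Equiv.piEquivPiSubtypeProd]
        · simp [MeasurableEquiv.piEquivPiSubtypeProd, Equiv.piEquivPiSubtypeProd]
      · refine Finset.prod_congr rfl fun i _ => ?_
        congr 1
        · ext s
          simp [MeasurableEquiv.piEquivPiSubtypeProd, Equiv.piEquivPiSubtypeProd]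
        · simp [MeasurableEquiv.piEquivPiSubtypeProd, Equiv.piEquivPiSubtypeProd, i.2]
    simp only [h1]
    rw [integral_const_mul, integral_fintype_prod_eq_prod (𝕜 := ℂ)
      (f := fun (i : {i // i ∉ S}) t => g i p t), ← Fintype.prod_subtype_mul_prod_subtype (· ∈ S)]
    congr 1
    · exact Finset.prod_congr rfl fun i _ => by rw [dif_pos i.2]
    · exact Finset.prod_congr rfl fun i _ => by rw [dif_neg i.2]
  · exact (hmp'.integrable_comp_emb (MeasurableEquiv.measurableEmbedding _)).2 hint

/-- A tie between two coordinates confines `y` to a proper subspace, which is Lebesgue null. -/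
lemma ae_injective_pi_unif (ι : Type*) [Fintype ι] :
    ∀ᵐ y : ι → ℝ ∂(Measure.pi fun _ => unif), Function.Injective y := by
  classical
  have : ∀ i j : ι, i ≠ j → ∀ᵐ y : ι → ℝ ∂(Measure.pi fun _ => unif), y i ≠ y j := by
    intro i j hij
    rw [← Measure.restrict_pi_pi]
    refine ae_restrict_of_ae ?_
    have h0 := Measure.addHaar_submodule (volume : Measure (ι → ℝ))
      (LinearMap.ker (LinearMap.proj (R := ℝ) (φ := fun _ : ι => ℝ) i - LinearMap.proj j)) (by
        intro h
        have : (Pi.single i 1 : ι → ℝ) ∈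
            LinearMap.ker (LinearMap.proj (R := ℝ) (φ := fun _ : ι => ℝ) i - LinearMap.proj j) := by
          rw [h]; trivial
        simp [hij.symm] at this)
    refine (ae_iff.2 (le_antisymm (le_trans (measure_mono fun y hy => ?_) h0.le) bot_le))
    have hy' : y i = y j := by simpa using hy
    simp [hy']
  have h2 : ∀ᵐ y : ι → ℝ ∂(Measure.pi fun _ => unif), ∀ i j, i ≠ j → y i ≠ y j := by
    rw [ae_all_iff]; intro i; rw [ae_all_iff]; intro j
    by_cases h : i = j
    · simp [h]
    · filter_upwards [this i j h] with y hy _ using hy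
  filter_upwards [h2] with y hy i j hij
  by_contra h
  exact hy i j h hij

lemma ae_mem_pi_unif (ι : Type*) [Fintype ι] :
    ∀ᵐ y : ι → ℝ ∂(Measure.pi fun _ => unif), ∀ i, y i ∈ Set.Ioo (0 : ℝ) 1 := by
  rw [ae_all_iff]
  intro i
  exact (measurePreserving_eval (fun _ : ι => unif) i).quasiMeasurePreserving.ae
    (ae_restrict_mem measurableSet_Ioo)

/-- The contribution of an edge outside the tree: `1` if it is absent, the density on labels below
`w` if it is present. The fundamental theorem of calculus merges the two. -/
lemma integral_unif_exp (u : ℂ) {w : ℝ} (hw : w ∈ Set.Icc (0 : ℝ) 1) :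
    ∫ t, (1 + if t < w then u * Complex.exp (u * t) else 0) ∂unif = Complex.exp (u * w) := by
  have hcont : Continuous fun t : ℝ => u * Complex.exp (u * t) := by fun_prop
  have hind : (fun t : ℝ => if t < w then u * Complex.exp (u * t) else 0) =
      (Set.Iio w).indicator fun t : ℝ => u * Complex.exp (u * t) := by
    ext t; simp [Set.indicator]
  have hi : Integrable (fun t : ℝ => u * Complex.exp (u * t)) unif :=
    (hcont.integrableOn_Icc (a := 0) (b := 1)).mono_set Set.Ioo_subset_Icc_self
  rw [integral_add (integrable_const _) (by rw [hind]; exact hi.indicator measurableSet_Iio), hind,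
    integral_indicator measurableSet_Iio, Measure.restrict_restrict measurableSet_Iio]
  have hset : Set.Iio w ∩ Set.Ioo 0 1 = Set.Ioo 0 w := by
    ext t
    simp only [Set.mem_inter_iff, Set.mem_Iio, Set.mem_Ioo]
    exact ⟨fun h => ⟨h.2.1, h.1⟩, fun h => ⟨h.2, h.1, h.2.trans_le hw.2⟩⟩
  rw [hset, ← integral_Ioc_eq_integral_Ioo (x := 0) (y := w), ← intervalIntegral.integral_of_le hw.1]
  have hd : ∀ t ∈ Set.uIcc 0 w, HasDerivAt (fun t : ℝ => Complex.exp (u * t))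
      (u * Complex.exp (u * t)) t := by
    intro t _
    have h1 : HasDerivAt (fun t : ℝ => u * (t : ℂ)) u t := by
      simpa using (Complex.ofRealCLM.hasDerivAt (x := t)).const_mul u
    simpa [mul_comm] using h1.cexp
  rw [intervalIntegral.integral_eq_sub_of_hasDerivAt hd (hcont.intervalIntegrable _ _)]
  simp

lemma integral_unif_exp_one (u : ℂ) :
    ∫ t, u * Complex.exp (u * t) ∂unif = Complex.exp u - 1 := by
  have h := integral_unif_exp u (w := 1) (by simp)
  have hcont : Continuous fun t : ℝ => u * Complex.exp (u * t) := by fun_prop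
  have hi : Integrable (fun t : ℝ => u * Complex.exp (u * t)) unif :=
    (hcont.integrableOn_Icc (a := 0) (b := 1)).mono_set Set.Ioo_subset_Icc_self
  have h2 : ∫ t, (1 + if t < (1 : ℝ) then u * Complex.exp (u * t) else 0) ∂unif =
      ∫ t, (1 + u * Complex.exp (u * t)) ∂unif := by
    refine setIntegral_congr_fun measurableSet_Ioo fun t ht => ?_
    simp only [if_pos ht.2]
  rw [h2, integral_add (integrable_const _) hi] at h
  simp at h
  rw [← h]; ring

variable {V : Type*} [Fintype V]

lemma sepMin_pos {T : SimpleGraph V} {y : Sym2 V → ℝ} (hy : ∀ e ∈ T.edgeSet, 0 < y e) (e : Sym2 V) :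
    0 < sepMin T y e :=
  lt_sepMin_iff.2 ⟨one_pos, fun f hf => hy f (mem_edgeSet_of_mem_sepEdges hf)⟩

open Classical in
/-- The density attached to a graph. -/
noncomputable def graphDensity (u : Sym2 V → ℂ) (G : SimpleGraph V) (y : Sym2 V → ℝ) : ℂ :=
  ∏ e, if e ∈ G.edgeSet then u e * Complex.exp (u e * y e) else 1

lemma integrable_graphDensity (u : Sym2 V → ℂ) (G : SimpleGraph V) :
    Integrable (graphDensity u G) (Measure.pi fun _ => unif) := by
  classical
  unfold graphDensity
  refine Integrable.fintype_prod (𝕜 := ℂ)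
    (f := fun e (t : ℝ) => if e ∈ G.edgeSet then u e * Complex.exp (u e * t) else 1) fun e => ?_
  split_ifs
  · have hcont : Continuous fun t : ℝ => u e * Complex.exp (u e * t) := by fun_prop
    exact (hcont.integrableOn_Icc (a := 0) (b := 1)).mono_set Set.Ioo_subset_Icc_self
  · exact integrable_const _

open Classical in
lemma prod_edgeSet_eq (f : Sym2 V → ℂ) (G : SimpleGraph V) :
    ∏ e, (if e ∈ G.edgeSet then f e else 1) = edgeProd f G := by
  rw [edgeProd, ← Finset.prod_filter]
  refine Finset.prod_congr ?_ fun _ _ => rfl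
  ext e; simp

lemma integral_graphDensity (u : Sym2 V → ℂ) (G : SimpleGraph V) :
    ∫ y, graphDensity u G y ∂(Measure.pi fun _ => unif) =
      edgeProd (fun e => Complex.exp (u e) - 1) G := by
  classical
  unfold graphDensity
  rw [integral_fintype_prod_eq_prod (𝕜 := ℂ)
    (f := fun e (t : ℝ) => if e ∈ G.edgeSet then u e * Complex.exp (u e * t) else 1),
    ← prod_edgeSet_eq]
  refine Finset.prod_congr rfl fun e _ => ?_
  split_ifs
  · exact integral_unif_exp_one _
  · simp

-- For fixed `T` and `y`, being a maximal spanning tree of `G` splits into one condition per edge: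
-- tree edges are present, and any other edge that is present has its label below `sepMin`. Hence
-- the sum over `G` factorises. Labels below `1` are needed because `sepMin` is capped at `1`.
open Classical in
lemma sum_isMaxSpan_graphDensity (u : Sym2 V → ℂ) {T : SimpleGraph V} {y : Sym2 V → ℝ}
    (hy : ∀ e, y e < 1) :
    ∑ G : SimpleGraph V, (if IsMaxSpan G T y then graphDensity u G y else 0) =
      ∏ e, if e ∈ T.edgeSet then u e * Complex.exp (u e * y e) else
        if e.IsDiag then 1 else
          1 + if y e < sepMin T y e then u e * Complex.exp (u e * y e) else 0 := by
  -- The first function vanishes on forbidden edges and the second on omitted tree edges, so every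
  -- graph violating `IsMaxSpan` gets a zero factor.
  have h := prod_nonDiag_add (V := V)
    (fun e => if e ∈ T.edgeSet ∨ y e < sepMin T y e then u e * Complex.exp (u e * y e) else 0)
    (fun e => if e ∈ T.edgeSet then 0 else 1)
  trans ∏ e ∈ nonDiag V, ((if e ∈ T.edgeSet ∨ y e < sepMin T y e then
    u e * Complex.exp (u e * y e) else 0) + (if e ∈ T.edgeSet then 0 else 1))
  · rw [h]
    refine Finset.sum_congr rfl fun G _ => ?_
    split_ifs with hG
    · rw [graphDensity, prod_edgeSet_eq (fun e => u e * Complex.exp (u e * y e)), edgeProd_eq]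
      refine Finset.prod_congr rfl fun e _ => ?_
      by_cases he : e ∈ G.edgeSet
      · rw [if_pos he, if_pos he, if_pos]
        by_contra hne
        push Not at hne
        exact absurd (lt_sepMin_iff.2 ⟨hy e, hG.2 e he hne.1⟩) (not_lt.2 hne.2)
      · rw [if_neg he, if_neg he, if_neg]
        exact fun h => he (SimpleGraph.edgeSet_subset_edgeSet.2 hG.1 h)
    · symm
      by_cases hTG : T ≤ G
      · have : ∃ e ∈ G.edgeSet, e ∉ T.edgeSet ∧ ¬ ∀ f ∈ sepEdges T e, y e < y f := by
          by_contra hc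
          push Not at hc
          exact hG ⟨hTG, fun e he heT => by simpa using hc e he heT⟩
        obtain ⟨e, he, heT, hlt⟩ := this
        refine Finset.prod_eq_zero (i := e) (mem_nonDiag.2 (G.not_isDiag_of_mem_edgeSet he)) ?_
        rw [if_pos he, if_neg]
        rintro (h | h)
        · exact heT h
        · exact hlt (lt_sepMin_iff.1 h).2
      · rw [← SimpleGraph.edgeSet_subset_edgeSet, Set.not_subset] at hTG
        obtain ⟨e, heT, he⟩ := hTG
        refine Finset.prod_eq_zero (i := e) (mem_nonDiag.2 (T.not_isDiag_of_mem_edgeSet heT)) ?_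
        rw [if_neg he, if_pos heT]
  · rw [← Finset.prod_subset (Finset.subset_univ (nonDiag V))]
    · refine Finset.prod_congr rfl fun e he => ?_
      rw [mem_nonDiag] at he
      by_cases heT : e ∈ T.edgeSet
      · simp [heT]
      · simp [heT, he, add_comm]
    · intro e _ he
      rw [mem_nonDiag, not_not] at he
      rw [if_neg (fun h => T.not_isDiag_of_mem_edgeSet h he), if_pos he]

open Classical in
/-- The Brydges–Kennedy identity: the sum over spanning trees is the connected part of the graph
expansion. -/
theorem sum_tree_integral_eq_sum_connected (u : Sym2 V → ℂ) :
    ∑ T : SimpleGraph V, (if T.IsTree then edgeProd u T *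
        ∫ x : T.edgeSet → ℝ, Complex.exp (∑ e ∈ nonDiag V, u e * sepMin T (extendZero x) e)
          ∂(Measure.pi fun _ => unif) else 0) =
      ∑ G : SimpleGraph V, if G.Connected then edgeProd (fun e => Complex.exp (u e) - 1) G else 0 := by
  have hint : ∀ G T : SimpleGraph V, Integrable
      (fun y => if IsMaxSpan G T y then graphDensity u G y else 0) (Measure.pi fun _ => unif) := by
    intro G T
    have : (fun y => if IsMaxSpan G T y then graphDensity u G y else 0) =
        {y | IsMaxSpan G T y}.indicator (graphDensity u G) := by
      ext y; simp [Set.indicator]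
    rw [this]
    exact (integrable_graphDensity u G).indicator (measurableSet_isMaxSpan G T)
  -- Labels are almost surely distinct, so each connected graph is counted at exactly one tree.
  have h1 : ∀ᵐ y ∂(Measure.pi fun _ : Sym2 V => unif),
      ∑ G : SimpleGraph V, (if G.Connected then graphDensity u G y else 0) =
      ∑ T : SimpleGraph V, if T.IsTree then
        ∑ G : SimpleGraph V, (if IsMaxSpan G T y then graphDensity u G y else 0) else 0 := by
    filter_upwards [ae_injective_pi_unif (Sym2 V)] with y hy
    have : ∀ T : SimpleGraph V, (if T.IsTree then
        ∑ G : SimpleGraph V, (if IsMaxSpan G T y then graphDensity u G y else 0) else 0) =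
        ∑ G : SimpleGraph V, if G.Connected ∧ T = maxSpan G y then graphDensity u G y else 0 := by
      intro T
      simp only [← isTree_and_isMaxSpan_iff hy]
      by_cases hT : T.IsTree <;> simp [hT]
    simp only [this]
    rw [Finset.sum_comm]
    refine Finset.sum_congr rfl fun G _ => ?_
    by_cases hG : G.Connected <;> simp [hG]
  have h2 : ∑ G : SimpleGraph V, (if G.Connected then edgeProd (fun e => Complex.exp (u e) - 1) G else 0) =
      ∫ y, ∑ G : SimpleGraph V, (if G.Connected then graphDensity u G y else 0)
        ∂(Measure.pi fun _ => unif) := by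
    rw [integral_finsetSum]
    · refine Finset.sum_congr rfl fun G _ => ?_
      split_ifs
      · rw [integral_graphDensity]
      · simp
    · intro G _
      split_ifs
      · exact integrable_graphDensity u G
      · exact integrable_zero _ _ _
  rw [h2, integral_congr_ae h1, integral_finsetSum]
  swap
  · intro T _
    split_ifs
    · exact integrable_finsetSum _ fun G _ => hint G T
    · exact integrable_zero _ _ _
  refine Finset.sum_congr rfl fun T _ => ?_
  split_ifs with hT
  swap
  · simp
  -- `sepMin T` reads only labels of tree edges, so the factor at `e` depends on the tree labels `p`
  -- and on its own label `t` alone, as `integral_pi_split` demands.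
  let g : Sym2 V → (T.edgeSet → ℝ) → ℝ → ℂ := fun e p t =>
    if e ∈ T.edgeSet then u e * Complex.exp (u e * t) else
      if e.IsDiag then 1 else
        1 + if t < sepMin T (extendZero p) e then u e * Complex.exp (u e * t) else 0
  have h3 : ∀ᵐ y ∂(Measure.pi fun _ : Sym2 V => unif),
      ∑ G : SimpleGraph V, (if IsMaxSpan G T y then graphDensity u G y else 0) =
        ∏ e, g e (fun s => y s) (y e) := by
    filter_upwards [ae_mem_pi_unif (Sym2 V)] with y hy
    rw [sum_isMaxSpan_graphDensity u fun e => (hy e).2]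
    have : ∀ e, sepMin T (extendZero fun s : T.edgeSet => y s) e = sepMin T y e := fun e =>
      sepMin_congr (fun e he => extendZero_of_mem _ he) e
    simp only [g, this]
  rw [integral_congr_ae h3, integral_pi_split unif T.edgeSet g
    ((integrable_finsetSum _ fun G _ => hint G T).congr h3),
    ← integral_const_mul (edgeProd u T)]
  refine integral_congr_ae ?_
  filter_upwards [ae_mem_pi_unif T.edgeSet] with x hx
  have hx' : ∀ e ∈ T.edgeSet, extendZero x e ∈ Set.Ioo (0 : ℝ) 1 := fun e he => by
    rw [extendZero_of_mem x he]; exact hx _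
  rw [Complex.exp_sum, ← prod_edgeSet_eq, ← Finset.prod_subset (Finset.subset_univ (nonDiag V)),
    ← Finset.prod_subset (Finset.subset_univ (nonDiag V)), ← Finset.prod_mul_distrib]
  · refine Finset.prod_congr rfl fun e he => ?_
    rw [mem_nonDiag] at he
    by_cases heT : e ∈ T.edgeSet
    · rw [if_pos heT, dif_pos heT, sepMin_of_mem hT.2 heT (hx' e heT).2.le, extendZero_of_mem x heT]
      simp [g, heT]
    · rw [if_neg heT, dif_neg heT, one_mul]
      simp only [g, if_neg heT, if_neg he]
      exact (integral_unif_exp _ ⟨(sepMin_pos (fun e he => (hx' e he).1) e).le,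
        sepMin_le_one _ _ _⟩).symm
  · intro e _ he
    rw [mem_nonDiag, not_not] at he
    have heT : e ∉ T.edgeSet := fun h => T.not_isDiag_of_mem_edgeSet h he
    rw [dif_neg heT]
    simp [g, heT, he]
  · intro e _ he
    rw [mem_nonDiag, not_not] at he
    rw [if_neg (fun h => T.not_isDiag_of_mem_edgeSet h he)]

end TreeIntegral

end TreeCumulant

namespace TreeCumulant

/-! ### Joint cumulants in terms of joint moments. -/

section CumulantFormula

variable {σ : Type*} [Fintype σ]

open Classical in
/-- The indicator of a finite set, as an exponent. -/
noncomputable def setExponent (S : Finset σ) : σ →₀ ℕ :=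
  Finsupp.equivFunOnFinite.symm fun i => if i ∈ S then 1 else 0

open Classical in
lemma setExponent_apply (S : Finset σ) (i : σ) : setExponent S i = if i ∈ S then 1 else 0 := rfl

lemma setExponent_univ : setExponent (Finset.univ : Finset σ) =
    Finsupp.equivFunOnFinite.symm fun _ => 1 := by
  ext i; simp [setExponent_apply]

lemma setExponent_empty : setExponent (∅ : Finset σ) = 0 := by
  ext i; simp [setExponent_apply]

-- Distributing a squarefree monomial over `d` factors means assigning each variable to one factor.
open Classical in
lemma coeff_univ_prod {R : Type*} [CommSemiring R] {d : ℕ} (f : Fin d → MvPowerSeries σ R) :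
    MvPowerSeries.coeff (setExponent Finset.univ) (∏ j, f j) =
      ∑ p : σ → Fin d, ∏ j, MvPowerSeries.coeff
        (setExponent (Finset.univ.filter fun i => p i = j)) (f j) := by
  rw [MvPowerSeries.coeff_prod]
  symm
  refine Finset.sum_nbij (fun p => Finsupp.equivFunOnFinite.symm fun j =>
    setExponent (Finset.univ.filter fun i => p i = j)) ?_ ?_ ?_ ?_
  · intro p _
    rw [Finset.mem_finsuppAntidiag]
    refine ⟨?_, Finset.subset_univ _⟩
    ext i
    simp [setExponent_apply, Finsupp.finsetSum_apply]
  · intro p _ q _ h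
    ext1 i
    have := DFunLike.congr_fun (DFunLike.congr_fun h (p i)) i
    simp [setExponent_apply] at this
    exact this.symm
  · intro l hl
    rw [Finset.mem_coe, Finset.mem_finsuppAntidiag] at hl
    have h1 : ∀ i, ∑ j, l j i = 1 := by
      intro i
      have := DFunLike.congr_fun hl.1 i
      simpa [setExponent_apply, Finsupp.finsetSum_apply] using this
    have h2 : ∀ i, ∃ j, ∀ j', l j' i = if j = j' then 1 else 0 := by
      intro i
      have : ∃ j, l j i ≠ 0 := by
        by_contra h
        push Not at h
        simpa [h] using h1 i
      obtain ⟨j, hj⟩ := this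
      have h3 := Finset.add_sum_erase Finset.univ (fun j => l j i) (Finset.mem_univ j)
      simp only [h1 i] at h3
      have h4 : ∑ j' ∈ Finset.univ.erase j, l j' i = 0 := by omega
      refine ⟨j, fun j' => ?_⟩
      split_ifs with h
      · subst h; omega
      · exact Finset.sum_eq_zero_iff.1 h4 j' (Finset.mem_erase.2 ⟨Ne.symm h, Finset.mem_univ _⟩)
    choose p hp using h2
    refine ⟨p, Finset.mem_univ _, ?_⟩
    ext j i
    simp [setExponent_apply, hp]
  · intro p _
    rfl

variable {Ω : Type*} [MeasurableSpace Ω] {k : ℕ}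

lemma coeff_momentSeries_setExponent (P : Measure Ω) (X : Fin k → Ω → ℂ) (S : Finset (Fin k)) :
    MvPowerSeries.coeff (setExponent S) (momentSeries P X) = ∫ ω, ∏ i ∈ S, X i ω ∂P := by
  classical
  change (∫ ω, ∏ i, X i ω ^ setExponent S i ∂P) / ∏ i, (Nat.factorial (setExponent S i) : ℂ) = _
  have h1 : ∏ i, (Nat.factorial (setExponent S i) : ℂ) = 1 := by
    refine Finset.prod_eq_one fun i _ => ?_
    rw [setExponent_apply]; split_ifs <;> simp
  have h2 : ∀ ω, ∏ i, X i ω ^ setExponent S i = ∏ i ∈ S, X i ω := by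
    intro ω
    simp only [setExponent_apply, pow_ite, pow_one, pow_zero]
    rw [Finset.prod_ite_mem, Finset.univ_inter]
  rw [h1, div_one]
  simp only [h2]

open Classical in
/-- The joint cumulant as a polynomial in the joint moments. -/
theorem jointCumulant_eq_sum (P : Measure Ω) [IsProbabilityMeasure P] (X : Fin k → Ω → ℂ) :
    jointCumulant P X = ∑ d ∈ Finset.range (k + 1), logCoeff d *
      ∑ p : {p : Fin k → Fin d // Function.Surjective p},
        ∏ j, ∫ ω, ∏ i with p.1 i = j, X i ω ∂P := by
  have h0 : MvPowerSeries.coeff 0 (momentSeries P X - 1) = 0 := by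
    rw [map_sub, ← setExponent_empty, coeff_momentSeries_setExponent, setExponent_empty]
    simp
  have hs : PowerSeries.HasSubst (momentSeries P X - 1) :=
    PowerSeries.HasSubst.of_constantCoeff_zero (by
      rw [← MvPowerSeries.coeff_zero_eq_constantCoeff_apply, h0])
  have h1 : ∀ S : Finset (Fin k), S.Nonempty →
      MvPowerSeries.coeff (setExponent S) (momentSeries P X - 1) = ∫ ω, ∏ i ∈ S, X i ω ∂P := by
    intro S hS
    rw [map_sub, coeff_momentSeries_setExponent, MvPowerSeries.coeff_one, if_neg, sub_zero]
    intro h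
    obtain ⟨i, hi⟩ := hS
    have := DFunLike.congr_fun h i
    simp [setExponent_apply, hi] at this
  -- The series has no constant term, so an empty fibre of `p` kills its summand and only
  -- surjections survive.
  have h2 : ∀ d, MvPowerSeries.coeff (setExponent Finset.univ) ((momentSeries P X - 1) ^ d) =
      ∑ p : {p : Fin k → Fin d // Function.Surjective p},
        ∏ j, ∫ ω, ∏ i with p.1 i = j, X i ω ∂P := by
    intro d
    have := coeff_univ_prod (σ := Fin k) fun _ : Fin d => momentSeries P X - 1
    rw [Finset.prod_const, Finset.card_univ, Fintype.card_fin] at this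
    rw [this, ← Finset.sum_subtype (Finset.univ.filter fun p : Fin k → Fin d => Function.Surjective p)
      (by simp) fun p : Fin k → Fin d => ∏ j, ∫ ω, ∏ i with p i = j, X i ω ∂P,
      Finset.sum_filter]
    refine Finset.sum_congr (by ext; simp) fun p _ => ?_
    split_ifs with hp
    · refine Finset.prod_congr rfl fun j _ => h1 _ ?_
      obtain ⟨i, hi⟩ := hp j
      exact ⟨i, by simpa using hi⟩
    · rw [Function.Surjective] at hp
      push Not at hp
      obtain ⟨j, hj⟩ := hp
      refine Finset.prod_eq_zero (Finset.mem_univ j) ?_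
      rw [Finset.filter_eq_empty_iff.2 (fun i _ => hj i), setExponent_empty, h0]
  rw [jointCumulant, cumulantSeries, ← setExponent_univ, PowerSeries.coeff_subst hs]
  simp only [h2]
  rw [finsum_eq_sum_of_support_subset (s := Finset.range (k + 1))]
  · refine Finset.sum_congr rfl fun d _ => ?_
    rw [PowerSeries.coeff_log, smul_eq_mul, logCoeff]
    split_ifs <;> simp
  -- There are no surjections onto more than `k` points, so the series of the logarithm may be cut
  -- after `d = k`.
  · intro d hd
    rw [Finset.coe_range, Set.mem_Iio]
    by_contra h
    have : IsEmpty {p : Fin k → Fin d // Function.Surjective p} :=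
      ⟨fun p => by
        have := Fintype.card_le_of_surjective p.1 p.2
        simp at this; omega⟩
    simp at hd

end CumulantFormula

end TreeCumulant

namespace TreeCumulant

/-! ### The weight matrix of a tree as the matrix of path minima. -/

section WeightMatrix

variable {k : ℕ}

/-- The matrix of least separating labels. -/
noncomputable def sepMatrix (T : SimpleGraph (Fin k)) (y : Sym2 (Fin k) → ℝ) :
    Matrix (Fin k) (Fin k) ℝ := fun i j => sepMin T y s(i, j)

lemma lt_sepMatrix_iff {T : SimpleGraph (Fin k)} (hT : T.IsTree) {y : Sym2 (Fin k) → ℝ} {t : ℝ}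
    {i j : Fin k} : t < sepMatrix T y i j ↔ t < 1 ∧ (above T y t).Reachable i j := by
  rw [sepMatrix, lt_sepMin_iff, reachable_above_iff hT]

lemma isCoUltrametric_sepMatrix {T : SimpleGraph (Fin k)} (hT : T.IsTree) {y : Sym2 (Fin k) → ℝ}
    (hy : ∀ e ∈ T.edgeSet, 0 < y e) : IsCoUltrametric (sepMatrix T y) where
  symm := by
    ext i j
    simp only [Matrix.transpose_apply, sepMatrix, Sym2.eq_swap]
  diag i := by
    refine le_antisymm (sepMin_le_one _ _ _) (le_of_forall_lt fun t ht => ?_)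
    exact (lt_sepMatrix_iff hT).2 ⟨ht, SimpleGraph.Reachable.refl _⟩
  mem_Icc i j := ⟨(sepMin_pos hy _).le, sepMin_le_one _ _ _⟩
  min_le i j l := by
    refine le_of_forall_lt fun t ht => ?_
    rw [lt_min_iff, lt_sepMatrix_iff hT, lt_sepMatrix_iff hT] at ht
    exact (lt_sepMatrix_iff hT).2 ⟨ht.1.1, ht.1.2.trans ht.2.2⟩

lemma sepMin_mem {V : Type*} [Fintype V] (T : SimpleGraph V) (y : Sym2 V → ℝ) (e : Sym2 V) :
    sepMin T y e = 1 ∨ ∃ f ∈ sepEdges T e, sepMin T y e = y f := by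
  have : ∀ s : Finset (Sym2 V), s.fold min 1 y = 1 ∨ ∃ f ∈ s, s.fold min 1 y = y f := by
    intro s
    induction s using Finset.cons_induction with
    | empty => simp
    | cons a s ha ih =>
      rw [Finset.fold_cons]
      rcases min_choice (y a) (s.fold min 1 y) with h | h
      · exact Or.inr ⟨a, Finset.mem_cons_self _ _, h⟩
      · rw [h]
        rcases ih with ih | ⟨f, hf, ih⟩
        · exact Or.inl ih
        · exact Or.inr ⟨f, Finset.mem_cons_of_mem hf, ih⟩
  exact this (sepEdges T e)

variable {T : SimpleGraph (Fin k)} {x : T.edgeSet → ℝ}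

lemma sepMatrix_extendZero_of_adj (hT : T.IsTree) (hx : ∀ e, x e ∈ Set.Ioo (0 : ℝ) 1)
    {i j : Fin k} (h : T.Adj i j) : sepMatrix T (extendZero x) i j = x ⟨s(i, j), h⟩ := by
  have he : s(i, j) ∈ T.edgeSet := h
  rw [sepMatrix, sepMin_of_mem hT.2 he, extendZero_of_mem x he]
  rw [extendZero_of_mem x he]
  exact (hx _).2.le

lemma extendZero_pos (hx : ∀ e, x e ∈ Set.Ioo (0 : ℝ) 1) : ∀ e ∈ T.edgeSet, 0 < extendZero x e := by
  intro e he
  rw [extendZero_of_mem x he]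
  exact (hx _).1

lemma entries_sepMatrix (hT : T.IsTree) (hx : ∀ e, x e ∈ Set.Ioo (0 : ℝ) 1) :
    {a : ℝ | ∃ i j, sepMatrix T (extendZero x) i j = a} \ {0, 1} = Set.range x := by
  ext a
  constructor
  · rintro ⟨⟨i, j, rfl⟩, ha⟩
    simp only [Set.mem_insert_iff, Set.mem_singleton_iff, not_or] at ha
    rcases sepMin_mem T (extendZero x) s(i, j) with h | ⟨f, hf, h⟩
    · exact absurd h ha.2
    · have hf := mem_edgeSet_of_mem_sepEdges hf
      exact ⟨⟨f, hf⟩, by rw [sepMatrix, h, extendZero_of_mem x hf]⟩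
  · rintro ⟨⟨e, he⟩, rfl⟩
    induction e with
    | _ i j =>
      refine ⟨⟨i, j, sepMatrix_extendZero_of_adj hT hx he⟩, ?_⟩
      simp only [Set.mem_insert_iff, Set.mem_singleton_iff, not_or]
      exact ⟨(hx _).1.ne', (hx _).2.ne⟩

/-- The entries other than `0` and `1` are the distinct labels, `k - 1` in number, and all entries
are positive, which leaves a single class. -/
lemma isWeight_sepMatrix (hT : T.IsTree) (hx : ∀ e, x e ∈ Set.Ioo (0 : ℝ) 1)
    (hinj : Function.Injective x) : IsWeight T x (sepMatrix T (extendZero x)) := by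
  classical
  have hart : articulation (sepMatrix T (extendZero x)) = T.edgeSet.ncard := by
    rw [articulation, entries_sepMatrix hT hx, ← Set.image_univ, Set.ncard_image_of_injective _ hinj,
      Set.ncard_univ]
    rfl
  refine ⟨isCoUltrametric_sepMatrix hT (extendZero_pos hx), ?_, hart, fun i j h =>
    sepMatrix_extendZero_of_adj hT hx h⟩
  have := hT.1.nonempty
  have hco : coArticulation (sepMatrix T (extendZero x)) = 1 := by
    have : (fun i : Fin k => {j : Fin k | 0 < sepMatrix T (extendZero x) i j}) =
        fun _ => Set.univ := by
      ext i j
      simpa [sepMatrix] using sepMin_pos (extendZero_pos hx) s(i, j)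
    rw [coArticulation, this, Set.range_const, Set.ncard_singleton]
  rw [IsGapless, hart, hco, Set.ncard_eq_toFinset_card']
  exact hT.card_edgeFinset.trans (Fintype.card_fin k)

/-- `H` has at most one edge more than `K`, so a connection in `H` either exists in `K` or can be
made to cross that edge once, in one of two directions. -/
lemma reachable_or_of_forall_adj {V : Type*} {K H : SimpleGraph V} {a b : V}
    (h : ∀ u v, H.Adj u v → K.Adj u v ∨ s(u, v) = s(a, b)) {i j : V}
    (hij : H.Reachable i j) : K.Reachable i j ∨ (K.Reachable i a ∧ K.Reachable b j) ∨
      (K.Reachable i b ∧ K.Reachable a j) := by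
  obtain ⟨w⟩ := hij
  induction w with
  | nil => exact Or.inl (SimpleGraph.Reachable.refl _)
  | cons huv _ ih =>
    rcases h _ _ huv with hK | he
    · exact ih.imp hK.reachable.trans
        (Or.imp (And.imp_left hK.reachable.trans) (And.imp_left hK.reachable.trans))
    · rcases Sym2.eq_iff.1 he with ⟨rfl, rfl⟩ | ⟨rfl, rfl⟩
      · rcases ih with ih | ih | ih
        · exact Or.inr (Or.inl ⟨SimpleGraph.Reachable.refl _, ih⟩)
        · exact Or.inr (Or.inl ⟨SimpleGraph.Reachable.refl _, ih.2⟩)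
        · exact Or.inl ih.2
      · rcases ih with ih | ih | ih
        · exact Or.inr (Or.inr ⟨SimpleGraph.Reachable.refl _, ih⟩)
        · exact Or.inl ih.2
        · exact Or.inr (Or.inr ⟨SimpleGraph.Reachable.refl _, ih.2⟩)

/-- The ultrametric inequality along the tree path gives the lower bound. If `A i j` exceeded the
least label `t` of the path, carried by the edge `{a, b}`, then going from `a` to `b` by way of `i`
and `j` would give `A a b > t`, although `A a b = t`. -/
lemma IsWeight.eq_sepMatrix (hT : T.IsTree) (hx : ∀ e, x e ∈ Set.Ioo (0 : ℝ) 1)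
    (hinj : Function.Injective x) {A : Matrix (Fin k) (Fin k) ℝ} (hA : IsWeight T x A) :
    A = sepMatrix T (extendZero x) := by
  have hpath : ∀ t < 1, ∀ i j, (above T (extendZero x) t).Reachable i j → t < A i j := by
    rintro t ht i j ⟨w⟩
    induction w with
    | nil => rw [hA.coUltrametric.diag]; exact ht
    | cons h _ ih =>
      refine lt_of_lt_of_le (lt_min ?_ ih) (hA.coUltrametric.min_le _ _ _)
      rw [hA.edge _ _ h.1, ← extendZero_of_mem x]
      exact h.2
  ext i j
  refine le_antisymm ?_ (le_of_forall_lt fun t ht => ?_)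
  · by_contra! hlt
    rcases sepMin_mem T (extendZero x) s(i, j) with h | ⟨f, hf, h⟩
    · exact absurd (hA.coUltrametric.mem_Icc i j).2 (not_le.2 (by rw [← h]; exact hlt))
    · have hfT := mem_edgeSet_of_mem_sepEdges hf
      set t := extendZero x f with ht
      have ht1 : t < 1 := by rw [ht, extendZero_of_mem x hfT]; exact (hx _).2
      have hinj' : ∀ e ∈ T.edgeSet, e ≠ f → extendZero x e ≠ t := by
        intro e he hef h'
        rw [ht, extendZero_of_mem x he, extendZero_of_mem x hfT] at h'
        exact hef (congrArg Subtype.val (hinj h'))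
      have hsep : ∀ e ∈ sepEdges T s(i, j), t ≤ extendZero x e := by
        intro e he
        by_contra! hlt'
        have h1 : ¬ extendZero x e < sepMin T (extendZero x) s(i, j) := fun h' =>
          lt_irrefl _ ((lt_sepMin_iff.1 h').2 e he)
        exact h1 (h ▸ hlt')
      -- By injectivity `f` is the only separating edge whose label is not above `t`; raising its
      -- label to `t + 1` therefore joins `i` and `j` above `t`, with `f` as the only additional
      -- edge.
      have hr := (reachable_above_iff hT (Function.update (extendZero x) f (t + 1)) t i j).2
        (fun e he => by
          by_cases hef : e = f
          · rw [hef, Function.update_self]; exact lt_add_one t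
          · rw [Function.update_of_ne hef]
            exact lt_of_le_of_ne (hsep e he)
              (hinj' e (mem_edgeSet_of_mem_sepEdges he) hef).symm)
      have hnr : ¬ (above T (extendZero x) t).Reachable i j := fun h' => by
        have := (lt_sepMatrix_iff hT).2 ⟨ht1, h'⟩
        rw [sepMatrix, h] at this
        exact lt_irrefl _ this
      have htr : ∀ i j l, t < A i j → t < A j l → t < A i l := fun i j l h h' =>
        (lt_min h h').trans_le (hA.coUltrametric.min_le i j l)
      have hs : ∀ i j, t < A i j → t < A j i := fun i j h => by
        rwa [hA.coUltrametric.symm.apply]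
      replace hlt : t < A i j := by rw [← h]; exact hlt
      clear_value t
      induction f with
      | _ a b =>
        have hab : A a b = t := by rw [hA.edge a b hfT, ht, extendZero_of_mem x hfT]
        rcases reachable_or_of_forall_adj (K := above T (extendZero x) t) (a := a) (b := b)
          (fun u v huv => by
            by_cases he : s(u, v) = s(a, b)
            · exact Or.inr he
            · refine Or.inl ⟨huv.1, ?_⟩
              have := huv.2
              rwa [Function.update_of_ne he] at this) hr with h' | h' | h'
        · exact hnr h'
        · have h1 := hpath t ht1 _ _ h'.1
          have h2 := hpath t ht1 _ _ h'.2
          have := htr _ _ _ (htr _ _ _ (hs _ _ h1) hlt) (hs _ _ h2)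
          exact absurd this (by rw [hab]; exact lt_irrefl _)
        · have h1 := hpath t ht1 _ _ h'.1
          have h2 := hpath t ht1 _ _ h'.2
          have := htr _ _ _ (htr _ _ _ h2 (hs _ _ hlt)) h1
          exact absurd this (by rw [hab]; exact lt_irrefl _)
  · rw [lt_sepMatrix_iff hT] at ht
    exact hpath t ht.1 i j ht.2

lemma weightMatrix_eq (hT : T.IsTree) (hx : ∀ e, x e ∈ Set.Ioo (0 : ℝ) 1)
    (hinj : Function.Injective x) : weightMatrix T x = sepMatrix T (extendZero x) := by
  have h : ∃! A, IsWeight T x A :=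
    ⟨_, isWeight_sepMatrix hT hx hinj, fun A hA => hA.eq_sepMatrix hT hx hinj⟩
  rw [weightMatrix, dif_pos h]
  exact (h.choose_spec.1).eq_sepMatrix hT hx hinj

end WeightMatrix

/-! ### Positivity of co-ultrametrics and the matrix square root. -/

section PositiveSemidefinite

variable {k : ℕ}

/-- The quadratic form of an equivalence relation is the sum over the classes of the squared class
sums. -/
lemma sum_mul_ite_eq_nonneg {ι β : Type*} [Fintype ι] [Finite β] (q : ι → β) (x : ι → ℝ) :
    0 ≤ ∑ i, ∑ j, x i * x j * {p : ι × ι | q p.1 = q p.2}.indicator 1 (i, j) := by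
  classical
  have := Fintype.ofFinite β
  have h : ∑ i, ∑ j, x i * x j * {p : ι × ι | q p.1 = q p.2}.indicator (1 : ι × ι → ℝ) (i, j) =
      ∑ c : β, (∑ i, if q i = c then x i else 0) ^ 2 := by
    simp only [pow_two, Finset.sum_mul_sum]
    rw [Finset.sum_comm' (t' := Finset.univ) (s' := fun _ => Finset.univ) (by simp)]
    rw [Finset.sum_comm]
    conv_rhs => rw [Finset.sum_comm]
    refine Finset.sum_congr rfl fun i _ => ?_
    rw [Finset.sum_comm]
    refine Finset.sum_congr rfl fun j _ => ?_
    simp [Set.indicator, eq_comm]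
  rw [h]
  exact Finset.sum_nonneg fun c _ => sq_nonneg _

/-- Layer cake: `A` is the integral over $t\in(0,1)$ of the indicator matrices of `t < A i j`, and
by the ultrametric inequality each of these is an equivalence relation. -/
lemma IsCoUltrametric.posSemidef {A : Matrix (Fin k) (Fin k) ℝ} (hA : IsCoUltrametric A) :
    A.PosSemidef := by
  classical
  have hent : ∀ i j, A i j = ∫ t in Set.Ioo (0 : ℝ) 1, (Set.Iio (A i j)).indicator 1 t := by
    intro i j
    rw [integral_indicator_one measurableSet_Iio, measureReal_def, Measure.restrict_apply measurableSet_Iio]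
    have : Set.Iio (A i j) ∩ Set.Ioo 0 1 = Set.Ioo 0 (A i j) := by
      ext t
      have := (hA.mem_Icc i j).2
      simp only [Set.mem_inter_iff, Set.mem_Iio, Set.mem_Ioo]
      exact ⟨fun h => ⟨h.2.1, h.1⟩, fun h => ⟨h.2, h.1, h.2.trans_le this⟩⟩
    rw [this, Real.volume_Ioo, sub_zero, ENNReal.toReal_ofReal (hA.mem_Icc i j).1]
  have hint : ∀ i j, Integrable ((Set.Iio (A i j)).indicator (1 : ℝ → ℝ))
      (volume.restrict (Set.Ioo (0 : ℝ) 1)) := fun i j =>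
    (integrable_const (1 : ℝ)).indicator measurableSet_Iio
  refine Matrix.PosSemidef.of_dotProduct_mulVec_nonneg ?_ fun x => ?_
  · exact hA.symm
  have h1 : star x ⬝ᵥ A.mulVec x = ∫ t in Set.Ioo (0 : ℝ) 1,
      ∑ i, ∑ j, x i * x j * (Set.Iio (A i j)).indicator 1 t := by
    rw [integral_finsetSum _ fun i _ => integrable_finsetSum _ fun j _ => (hint i j).const_mul _]
    simp only [dotProduct, Matrix.mulVec, Finset.mul_sum]
    refine Finset.sum_congr rfl fun i _ => ?_
    rw [integral_finsetSum _ fun j _ => (hint i j).const_mul _]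
    refine Finset.sum_congr rfl fun j _ => ?_
    rw [integral_const_mul, ← hent]
    simp; ring
  rw [h1]
  refine setIntegral_nonneg measurableSet_Ioo fun t ht => ?_
  have h2 := sum_mul_ite_eq_nonneg (fun i : Fin k => {j | t < A i j}) x
  have h3 : ∀ i j, t < A i j ↔ {l | t < A i l} = {l | t < A j l} := by
    have hs : ∀ i j, t < A i j → t < A j i := fun i j h => by rwa [hA.symm.apply]
    have htr : ∀ i j l, t < A i j → t < A j l → t < A i l := fun i j l h h' =>
      (lt_min h h').trans_le (hA.min_le i j l)
    intro i j
    constructor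
    · intro h
      ext l
      exact ⟨fun h' => htr _ _ _ (hs _ _ h) h', fun h' => htr _ _ _ h h'⟩
    · intro h
      have : j ∈ {l | t < A j l} := by simpa [hA.diag] using ht.2
      rwa [← h] at this
  convert h2 using 6 with i _ j _
  simp only [Set.indicator, Set.mem_Iio, Set.mem_ofPred_eq, h3 i j]
  rfl

open scoped MatrixOrder in
lemma matrixSqrt_mul_self {A : Matrix (Fin k) (Fin k) ℝ} (hA : A.PosSemidef) :
    matrixSqrt A * matrixSqrt A = A :=
  CFC.sqrt_mul_sqrt_self A (Matrix.nonneg_iff_posSemidef.2 hA)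

open scoped MatrixOrder in
lemma matrixSqrt_isSymm (A : Matrix (Fin k) (Fin k) ℝ) : (matrixSqrt A).IsSymm := by
  have : (matrixSqrt A).PosSemidef := Matrix.nonneg_iff_posSemidef.1 (CFC.sqrt_nonneg A)
  exact this.isHermitian

lemma sum_matrixSqrt_mul {A : Matrix (Fin k) (Fin k) ℝ} (hA : A.PosSemidef) (i j : Fin k) :
    ∑ l, matrixSqrt A i l * matrixSqrt A j l = A i j := by
  conv_rhs => rw [← matrixSqrt_mul_self hA, Matrix.mul_apply]
  exact Finset.sum_congr rfl fun l _ => by rw [(matrixSqrt_isSymm A).apply j l]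

/-- The rows of the square root are unit vectors. The resulting bound, uniform in the weights, gives
the exponential moments of $\sqrt A\,Z$. -/
lemma abs_matrixSqrt_le_one {A : Matrix (Fin k) (Fin k) ℝ} (hA : A.PosSemidef)
    (hd : ∀ i, A i i = 1) (i j : Fin k) : |matrixSqrt A i j| ≤ 1 := by
  have h := sum_matrixSqrt_mul hA i i
  rw [hd] at h
  rw [abs_le_one_iff_mul_self_le_one, ← h]
  exact Finset.single_le_sum (f := fun l => matrixSqrt A i l * matrixSqrt A i l)
    (fun l _ => mul_self_nonneg _) (Finset.mem_univ j)

instance instBorelSpaceMatrix (k n : ℕ) : BorelSpace (Matrix (Fin k) (Fin n) ℝ) :=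
  inferInstanceAs (BorelSpace (Fin k → Fin n → ℝ))

open scoped MatrixOrder Matrix.Norms.L2Operator in
lemma continuousOn_matrixSqrt :
    ContinuousOn (matrixSqrt (k := k)) {A | 0 ≤ A} := by
  have h : ContinuousOn (fun A : Matrix (Fin k) (Fin k) ℝ => cfc NNReal.sqrt A) {A | 0 ≤ A} :=
    ContinuousOn.cfc_nnreal_of_mem_nhdsSet (s := Set.univ) NNReal.sqrt Filter.univ_mem
      continuousOn_id (fun A hA => hA) NNReal.continuous_sqrt.continuousOn
  refine h.congr fun A _ => ?_
  exact CFC.sqrt_eq_cfc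

lemma isClosed_posSemidef : IsClosed {A : Matrix (Fin k) (Fin k) ℝ | A.PosSemidef} := by
  have : {A : Matrix (Fin k) (Fin k) ℝ | A.PosSemidef} =
      {A | A.transpose = A} ∩ ⋂ x : Fin k → ℝ, {A | 0 ≤ x ⬝ᵥ A.mulVec x} := by
    ext A
    simp only [Set.mem_inter_iff, Set.mem_iInter, Set.mem_ofPred_eq]
    exact ⟨fun h => ⟨h.isHermitian, fun x => h.dotProduct_mulVec_nonneg x⟩,
      fun h => Matrix.PosSemidef.of_dotProduct_mulVec_nonneg h.1 h.2⟩
  rw [this]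
  refine (isClosed_eq (by fun_prop) continuous_id).inter (isClosed_iInter fun x => ?_)
  exact isClosed_le continuous_const (by fun_prop)

-- The square root is continuous on the closed cone of positive semidefinite matrices and takes the
-- default value `0` off it.
open scoped MatrixOrder in
lemma measurable_matrixSqrt : Measurable (matrixSqrt (k := k)) := by
  classical
  have hclosed : IsClosed {A : Matrix (Fin k) (Fin k) ℝ | 0 ≤ A} := by
    simpa only [Matrix.nonneg_iff_posSemidef] using isClosed_posSemidef (k := k)
  have h := continuousOn_matrixSqrt.measurable_piecewise
    (continuousOn_const (c := (0 : Matrix (Fin k) (Fin k) ℝ))) hclosed.measurableSet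
  convert h using 1
  ext1 A
  by_cases hA : 0 ≤ A
  · rw [Set.piecewise_eq_of_mem _ _ _ (show A ∈ {A : Matrix (Fin k) (Fin k) ℝ | 0 ≤ A} from hA)]
  · rw [Set.piecewise_eq_of_notMem _ _ _ (show A ∉ {A : Matrix (Fin k) (Fin k) ℝ | 0 ≤ A} from hA)]
    exact CFC.sqrt_of_not_nonneg hA

end PositiveSemidefinite

end TreeCumulant

namespace TreeCumulant

/-! ### Iterated partial derivatives and tree operators on tensor products. -/

section PartialDerivatives

variable {k n : ℕ}

/-- Iterated partial derivatives: `∂_{j₁} ⋯ ∂_{j_m} f` for the list `[j₁, …, j_m]`. -/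
noncomputable def pd (a : List (Fin n)) (f : EuclideanSpace ℝ (Fin n) → ℂ) :
    EuclideanSpace ℝ (Fin n) → ℂ :=
  a.foldr (fun j g x => lineDeriv ℝ g x (EuclideanSpace.single j 1)) f

lemma pd_nil (f : EuclideanSpace ℝ (Fin n) → ℂ) : pd [] f = f := rfl

lemma pd_cons (j : Fin n) (a : List (Fin n)) (f : EuclideanSpace ℝ (Fin n) → ℂ) :
    pd (j :: a) f = fun x => lineDeriv ℝ (pd a f) x (EuclideanSpace.single j 1) := rfl

lemma pd_append (a b : List (Fin n)) (f : EuclideanSpace ℝ (Fin n) → ℂ) :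
    pd (a ++ b) f = pd a (pd b f) := List.foldr_append

lemma contDiff_lineDeriv {f : EuclideanSpace ℝ (Fin n) → ℂ} (hf : ContDiff ℝ (⊤ : ℕ∞) f)
    (v : EuclideanSpace ℝ (Fin n)) : ContDiff ℝ (⊤ : ℕ∞) fun x => lineDeriv ℝ f x v := by
  have : (fun x => lineDeriv ℝ f x v) = fun x => fderiv ℝ f x v := by
    ext x
    exact (hf.differentiable (by simp) x).lineDeriv_eq_fderiv
  rw [this]
  exact (hf.fderiv_right (m := (⊤ : ℕ∞)) le_rfl).clm_apply contDiff_const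

lemma contDiff_pd {f : EuclideanSpace ℝ (Fin n) → ℂ} (hf : ContDiff ℝ (⊤ : ℕ∞) f)
    (a : List (Fin n)) : ContDiff ℝ (⊤ : ℕ∞) (pd a f) := by
  induction a with
  | nil => exact hf
  | cons j a ih => exact contDiff_lineDeriv ih _

lemma pd_eq_iteratedFDeriv {f : EuclideanSpace ℝ (Fin n) → ℂ} (hf : ContDiff ℝ (⊤ : ℕ∞) f)
    (a : List (Fin n)) (x : EuclideanSpace ℝ (Fin n)) :
    pd a f x = iteratedFDeriv ℝ a.length f x fun r => EuclideanSpace.single (a.get r) (1 : ℝ) := by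
  induction a generalizing x with
  | nil => simp [pd_nil]
  | cons j a ih =>
    have h1 : pd a f = fun x => iteratedFDeriv ℝ a.length f x
      fun r => EuclideanSpace.single (a.get r) (1 : ℝ) := funext ih
    have hd : DifferentiableAt ℝ (iteratedFDeriv ℝ a.length f) x :=
      (hf.differentiable_iteratedFDeriv (by exact_mod_cast WithTop.coe_lt_top _)) x
    have hd' : DifferentiableAt ℝ (pd a f) x := (contDiff_pd hf a).differentiable (by simp) x
    simp only [pd_cons]
    rw [hd'.lineDeriv_eq_fderiv, h1, fderiv_continuousMultilinear_apply_const_apply hd]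
    exact (iteratedFDeriv_succ_apply_left (n := a.length)
      (fun r => EuclideanSpace.single ((j :: a).get r) (1 : ℝ))).symm

lemma Tame.expGrowth_pd {f : EuclideanSpace ℝ (Fin n) → ℂ} (hf : Tame f) (a : List (Fin n)) :
    ExpGrowth (pd a f) := by
  rw [show pd a f = _ from funext (pd_eq_iteratedFDeriv hf.smooth a)]
  exact hf.growth a.length _

lemma partialD_tensorProd (i : Fin k) (j : Fin n) (f : Fin k → EuclideanSpace ℝ (Fin n) → ℂ) :
    partialD i j (tensorProd f) = tensorProd (Function.update f i fun y =>
      lineDeriv ℝ (f i) y (EuclideanSpace.single j 1)) := by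
  ext x
  have h1 : ∀ t : ℝ, tensorProd f (x + t • Matrix.single i j 1) =
      f i (WithLp.toLp 2 (x i) + t • EuclideanSpace.single j 1) *
        ∏ l ∈ Finset.univ.erase i, f l (WithLp.toLp 2 (x l)) := by
    intro t
    rw [tensorProd, ← Finset.mul_prod_erase _ _ (Finset.mem_univ i)]
    congr 1
    · congr 1
      ext j'
      simp [Matrix.single_apply, eq_comm]
    · refine Finset.prod_congr rfl fun l hl => ?_
      congr 1
      ext j'
      simp [(Finset.ne_of_mem_erase hl).symm]
  rw [partialD, lineDeriv]
  simp only [h1]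
  rw [deriv_mul_const_field, tensorProd, ← Finset.mul_prod_erase _ _ (Finset.mem_univ i),
    Function.update_self]
  congr 1
  refine Finset.prod_congr rfl fun l hl => ?_
  rw [Function.update_of_ne (Finset.ne_of_mem_erase hl)]

/-- The multi-index `a` with `j` added to the list at `i`. -/
def consAt (i : Fin k) (j : Fin n) (a : Fin k → List (Fin n)) : Fin k → List (Fin n) :=
  Function.update a i (j :: a i)

lemma partialD_tensorProd_pd (i : Fin k) (j : Fin n) (a : Fin k → List (Fin n))
    (f : Fin k → EuclideanSpace ℝ (Fin n) → ℂ) :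
    partialD i j (tensorProd fun l => pd (a l) (f l)) =
      tensorProd fun l => pd (consAt i j a l) (f l) := by
  rw [partialD_tensorProd]
  congr 1
  ext1 l
  by_cases h : l = i
  · subst h
    simp [consAt, pd_cons]
  · simp [consAt, h]

lemma differentiableAt_tensorProd_line {f : Fin k → EuclideanSpace ℝ (Fin n) → ℂ}
    (hf : ∀ i, Differentiable ℝ (f i)) (x v : Matrix (Fin k) (Fin n) ℝ) :
    LineDifferentiableAt ℝ (tensorProd f) x v := by
  unfold LineDifferentiableAt tensorProd
  refine DifferentiableAt.fun_finsetProd fun i _ => ?_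
  have h : DifferentiableAt ℝ (fun t : ℝ => WithLp.toLp 2 (x i) + t • WithLp.toLp 2 (v i)) 0 := by
    fun_prop
  exact ((hf i).differentiableAt.comp (0 : ℝ) h)

lemma partialD_sum {ι : Type*} [Fintype ι] (i : Fin k) (j : Fin n)
    {F : ι → Matrix (Fin k) (Fin n) ℝ → ℂ}
    (hF : ∀ c x, LineDifferentiableAt ℝ (F c) x (Matrix.single i j 1)) :
    partialD i j (fun x => ∑ c, F c x) = fun x => ∑ c, partialD i j (F c) x := by
  ext x
  simp only [partialD, lineDeriv]
  exact deriv_fun_sum fun c _ => hF c x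

/-- A product of edge operators maps tensor products of smooth functions to finite sums of such,
with universal multi-indices. -/
lemma exists_foldr_edgeOp_eq_sum (L : List (Sym2 (Fin k))) :
    ∃ (ι : Type) (_ : Fintype ι) (a : ι → Fin k → List (Fin n)),
      ∀ f : Fin k → EuclideanSpace ℝ (Fin n) → ℂ, (∀ i, ContDiff ℝ (⊤ : ℕ∞) (f i)) →
        L.foldr edgeOp (tensorProd f) = fun x => ∑ c, tensorProd (fun i => pd (a c i) (f i)) x := by
  induction L with
  | nil => exact ⟨Unit, inferInstance, fun _ _ => [], fun f _ => by simp [pd_nil]⟩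
  | cons e L ih =>
    obtain ⟨ι, _, a, ha⟩ := ih
    refine ⟨Fin n × ι, inferInstance,
      fun c => consAt e.inf c.1 (consAt e.sup c.1 (a c.2)), fun f hf => ?_⟩
    have hd : ∀ (b : Fin k → List (Fin n)) x v,
        LineDifferentiableAt ℝ (tensorProd fun i => pd (b i) (f i)) x v := fun b x v =>
      differentiableAt_tensorProd_line (fun i => (contDiff_pd (hf i) _).differentiable (by simp)) x v
    rw [List.foldr_cons, ha f hf]
    ext x
    rw [edgeOp, Fintype.sum_prod_type]
    refine Finset.sum_congr rfl fun j _ => ?_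
    rw [partialD_sum _ _ fun c x => hd _ _ _]
    simp only [partialD_tensorProd_pd]
    rw [partialD_sum _ _ fun c x => hd _ _ _]
    simp only [partialD_tensorProd_pd]

end PartialDerivatives

/-! ### Characters as joint eigenfunctions of the tree operators. -/

section Exponentials

variable {k n : ℕ}

/-- The character `x ↦ exp (2πi ⟨ξ, x⟩)`. -/
noncomputable def expo (ξ x : EuclideanSpace ℝ (Fin n)) : ℂ :=
  Complex.exp ((2 * Real.pi * inner ℝ ξ x : ℝ) * Complex.I)

lemma contDiff_expo (ξ : EuclideanSpace ℝ (Fin n)) : ContDiff ℝ (⊤ : ℕ∞) (expo ξ) := by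
  unfold expo
  have : ContDiff ℝ (⊤ : ℕ∞) fun x : EuclideanSpace ℝ (Fin n) => 2 * Real.pi * inner ℝ ξ x :=
    contDiff_const.mul (contDiff_const.inner ℝ contDiff_id)
  exact ((Complex.ofRealCLM.contDiff.comp this).mul contDiff_const).cexp

/-- The symbol of `∂_j`. -/
noncomputable def symb (ξ : EuclideanSpace ℝ (Fin n)) (j : Fin n) : ℂ :=
  2 * Real.pi * Complex.I * ξ j

lemma lineDeriv_expo (ξ x : EuclideanSpace ℝ (Fin n)) (j : Fin n) :
    lineDeriv ℝ (expo ξ) x (EuclideanSpace.single j 1) = symb ξ j * expo ξ x := by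
  have h : HasDerivAt (fun t : ℝ => expo ξ (x + t • EuclideanSpace.single j 1))
      (symb ξ j * expo ξ x) 0 := by
    have h0 : ∀ t : ℝ, expo ξ (x + t • EuclideanSpace.single j 1) =
        Complex.exp (symb ξ j * t) * expo ξ x := by
      intro t
      rw [expo, expo, ← Complex.exp_add, inner_add_right, inner_smul_right]
      congr 1
      rw [EuclideanSpace.inner_single_right, symb]
      push_cast
      simp
      ring
    simp only [h0]
    have h1 : HasDerivAt (fun t : ℝ => symb ξ j * (t : ℂ)) (symb ξ j) 0 := by
      simpa using (Complex.ofRealCLM.hasDerivAt (x := (0 : ℝ))).const_mul (symb ξ j)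
    simpa using h1.cexp.mul_const (expo ξ x)
  exact h.deriv

lemma pd_expo (a : List (Fin n)) (ξ : EuclideanSpace ℝ (Fin n)) :
    pd a (expo ξ) = fun x => (a.map (symb ξ)).prod * expo ξ x := by
  induction a with
  | nil => simp [pd_nil]
  | cons j a ih =>
    rw [pd_cons, ih]
    ext x
    rw [lineDeriv, deriv_const_mul_field, List.map_cons, List.prod_cons]
    have := lineDeriv_expo ξ x j
    rw [lineDeriv] at this
    rw [this]; ring

/-- The symbols of the edge operators. -/
noncomputable def gramLabel (ξ : Fin k → EuclideanSpace ℝ (Fin n)) : Sym2 (Fin k) → ℂ :=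
  Sym2.lift ⟨fun i j => ((-(4 * Real.pi ^ 2 * inner ℝ (ξ i) (ξ j)) : ℝ) : ℂ), fun i j => by
    simp only [real_inner_comm]⟩

lemma gramLabel_mk (ξ : Fin k → EuclideanSpace ℝ (Fin n)) (i j : Fin k) :
    gramLabel ξ s(i, j) = ((-(4 * Real.pi ^ 2 * inner ℝ (ξ i) (ξ j)) : ℝ) : ℂ) := rfl

lemma partialD_const_mul_tensorProd_expo (i : Fin k) (j : Fin n) (c : ℂ)
    (ξ : Fin k → EuclideanSpace ℝ (Fin n)) :
    partialD i j (fun x => c * tensorProd (fun l => expo (ξ l)) x) =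
      fun x => (symb (ξ i) j * c) * tensorProd (fun l => expo (ξ l)) x := by
  ext x
  have h := congrFun (partialD_tensorProd i j fun l => expo (ξ l)) x
  rw [partialD, lineDeriv] at h ⊢
  rw [deriv_const_mul_field, h, tensorProd, tensorProd,
    ← Finset.mul_prod_erase _ _ (Finset.mem_univ i), ← Finset.mul_prod_erase _ _ (Finset.mem_univ i),
    Function.update_self, lineDeriv_expo]
  have : ∏ l ∈ Finset.univ.erase i, Function.update (fun l => expo (ξ l)) i (fun y =>
      lineDeriv ℝ (expo (ξ i)) y (EuclideanSpace.single j 1)) l (WithLp.toLp 2 (x l)) =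
      ∏ l ∈ Finset.univ.erase i, expo (ξ l) (WithLp.toLp 2 (x l)) :=
    Finset.prod_congr rfl fun l hl => by
      rw [Function.update_of_ne (Finset.ne_of_mem_erase hl)]
  rw [this]; ring

lemma sum_symb_mul_symb (ξ : Fin k → EuclideanSpace ℝ (Fin n)) (e : Sym2 (Fin k)) :
    ∑ j, symb (ξ e.inf) j * symb (ξ e.sup) j = gramLabel ξ e := by
  have he : e = s(e.inf, e.sup) := (Sym2.sortEquiv.symm_apply_apply e).symm
  conv_rhs => rw [he, gramLabel_mk]
  simp only [symb, PiLp.inner_apply]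
  push_cast
  rw [Finset.mul_sum, ← Finset.sum_neg_distrib]
  refine Finset.sum_congr rfl fun j _ => ?_
  simp
  linear_combination (4 * (Real.pi : ℂ) ^ 2 * (ξ e.inf j : ℂ) * (ξ e.sup j : ℂ)) * Complex.I_sq

lemma foldr_edgeOp_expo (L : List (Sym2 (Fin k))) (ξ : Fin k → EuclideanSpace ℝ (Fin n)) :
    L.foldr edgeOp (tensorProd fun l => expo (ξ l)) =
      fun x => (L.map (gramLabel ξ)).prod * tensorProd (fun l => expo (ξ l)) x := by
  induction L with
  | nil => simp
  | cons e L ih =>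
    rw [List.foldr_cons, ih]
    ext x
    rw [edgeOp]
    simp only [partialD_const_mul_tensorProd_expo]
    rw [← Finset.sum_mul, List.map_cons, List.prod_cons, ← sum_symb_mul_symb]
    congr 1
    rw [Finset.sum_mul]
    exact Finset.sum_congr rfl fun j _ => by ring

lemma treeOp_expo (T : SimpleGraph (Fin k)) (ξ : Fin k → EuclideanSpace ℝ (Fin n)) :
    treeOp T (tensorProd fun l => expo (ξ l)) =
      fun x => edgeProd (gramLabel ξ) T * tensorProd (fun l => expo (ξ l)) x := by
  classical
  rw [treeOp, foldr_edgeOp_expo]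
  have : edgeProd (gramLabel ξ) T =
      (T.edgeSet.toFinite.toFinset.toList.map (gramLabel ξ)).prod := by
    rw [Finset.prod_map_toList, edgeProd]
    refine Finset.prod_congr ?_ fun _ _ => rfl
    ext e; simp
  rw [this]

end Exponentials

end TreeCumulant

namespace TreeCumulant

/-! ### From characters to Schwartz functions by Fourier inversion. -/

section SchwartzRepresentation

variable {k n : ℕ}

open scoped SchwartzMap FourierTransform LineDeriv

lemma exists_schwartz_pd (f : 𝓢(EuclideanSpace ℝ (Fin n), ℂ)) (a : List (Fin n)) :
    ∃ g : 𝓢(EuclideanSpace ℝ (Fin n), ℂ), pd a f = g ∧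
      ∀ ξ, 𝓕 g ξ = (a.map (symb ξ)).prod * 𝓕 f ξ := by
  induction a with
  | nil => exact ⟨f, rfl, fun ξ => by simp⟩
  | cons j a ih =>
    obtain ⟨g, hg, hF⟩ := ih
    refine ⟨∂_{EuclideanSpace.single j (1 : ℝ)} g, ?_, fun ξ => ?_⟩
    · ext x
      rw [pd_cons, hg, SchwartzMap.lineDerivOp_apply]
    · have hm : (fun ξ : EuclideanSpace ℝ (Fin n) =>
          inner ℝ ξ (EuclideanSpace.single j (1 : ℝ))).HasTemperateGrowth := by fun_prop
      rw [SchwartzMap.fourier_lineDerivOp_eq, smul_apply,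
        SchwartzMap.smulLeftCLM_apply_apply hm, hF, List.map_cons, List.prod_cons, symb,
        EuclideanSpace.inner_single_right]
      simp
      ring

lemma integrable_fourier_mul_symb (f : 𝓢(EuclideanSpace ℝ (Fin n), ℂ)) (a : List (Fin n)) :
    Integrable fun ξ => 𝓕 f ξ * (a.map (symb ξ)).prod := by
  obtain ⟨g, -, hF⟩ := exists_schwartz_pd f a
  refine (𝓕 g).integrable.congr (Filter.Eventually.of_forall fun ξ => ?_)
  simp only [hF]; ring

lemma pd_schwartz_eq_integral (f : 𝓢(EuclideanSpace ℝ (Fin n), ℂ)) (a : List (Fin n))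
    (x : EuclideanSpace ℝ (Fin n)) : pd a f x = ∫ ξ, 𝓕 f ξ * pd a (expo ξ) x := by
  obtain ⟨g, hg, hF⟩ := exists_schwartz_pd f a
  have h1 : g x = 𝓕⁻ (𝓕 g) x := by rw [FourierTransform.fourierInv_fourier_eq]
  rw [hg, h1, SchwartzMap.fourierInv_coe, Real.fourierInv_eq']
  refine integral_congr_ae (Filter.Eventually.of_forall fun ξ => ?_)
  simp only [hF, pd_expo, smul_eq_mul, expo]
  ring

lemma norm_expo (ξ x : EuclideanSpace ℝ (Fin n)) : ‖expo ξ x‖ = 1 :=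
  Complex.norm_exp_ofReal_mul_I _

lemma continuous_expo : Continuous fun p : EuclideanSpace ℝ (Fin n) × EuclideanSpace ℝ (Fin n) =>
    expo p.1 p.2 := by
  unfold expo
  fun_prop

/-- The integral of a product of partial derivatives of functions of the rows. -/
noncomputable def rowIntegral (μ : Measure (Fin k → EuclideanSpace ℝ (Fin n)))
    (a : Fin k → List (Fin n)) (f : Fin k → EuclideanSpace ℝ (Fin n) → ℂ) : ℂ :=
  ∫ y, ∏ i, pd (a i) (f i) (y i) ∂μ

/-- Characters have modulus one, and the polynomial symbols produced by differentiation are absorbed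
by the Fourier transforms, giving transforms of Schwartz derivatives. -/
lemma integrable_fourier_mul_pd_expo (μ : Measure (Fin k → EuclideanSpace ℝ (Fin n)))
    [IsProbabilityMeasure μ] (a : Fin k → List (Fin n))
    (f : Fin k → 𝓢(EuclideanSpace ℝ (Fin n), ℂ)) :
    Integrable (fun p : (Fin k → EuclideanSpace ℝ (Fin n)) × (Fin k → EuclideanSpace ℝ (Fin n)) =>
      ∏ i, (𝓕 (f i) (p.2 i) * pd (a i) (expo (p.2 i)) (p.1 i))) (μ.prod volume) := by
  have h1 : Integrable (fun ξ : Fin k → EuclideanSpace ℝ (Fin n) =>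
      ∏ i, (𝓕 (f i) (ξ i) * ((a i).map (symb (ξ i))).prod)) volume :=
    Integrable.fintype_prod (𝕜 := ℂ) fun i => integrable_fourier_mul_symb (f i) (a i)
  have h2 : Integrable (fun p : (Fin k → EuclideanSpace ℝ (Fin n)) ×
      (Fin k → EuclideanSpace ℝ (Fin n)) =>
      ∏ i, (𝓕 (f i) (p.2 i) * ((a i).map (symb (p.2 i))).prod)) (μ.prod volume) := h1.comp_snd μ
  have hc : Continuous fun p : (Fin k → EuclideanSpace ℝ (Fin n)) ×
      (Fin k → EuclideanSpace ℝ (Fin n)) => ∏ i, expo (p.2 i) (p.1 i) := by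
    refine continuous_finsetProd _ fun i _ => ?_
    exact continuous_expo.comp (by fun_prop : Continuous fun p : (Fin k → EuclideanSpace ℝ (Fin n)) ×
      (Fin k → EuclideanSpace ℝ (Fin n)) => (p.2 i, p.1 i))
  refine (h2.mul_bdd (c := 1) hc.aestronglyMeasurable
    (Filter.Eventually.of_forall fun p => ?_)).congr (Filter.Eventually.of_forall fun p => ?_)
  · rw [norm_prod]
    simp [norm_expo]
  · simp only [pd_expo]
    rw [← Finset.prod_mul_distrib]
    exact Finset.prod_congr rfl fun i _ => by ring

/-- Fourier inversion in every factor, then Fubini. The weight `∏ i, 𝓕 (f i) (ξ i)` does not depend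
on `μ` or `a`, so linear relations between row integrals carry over. -/
lemma rowIntegral_schwartz (μ : Measure (Fin k → EuclideanSpace ℝ (Fin n)))
    [IsProbabilityMeasure μ] (a : Fin k → List (Fin n))
    (f : Fin k → 𝓢(EuclideanSpace ℝ (Fin n), ℂ)) :
    rowIntegral μ a (fun i => f i) =
      ∫ ξ : Fin k → EuclideanSpace ℝ (Fin n), (∏ i, 𝓕 (f i) (ξ i)) *
        rowIntegral μ a fun i => expo (ξ i) := by
  have h1 : ∀ y : Fin k → EuclideanSpace ℝ (Fin n), ∏ i, pd (a i) (f i) (y i) =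
      ∫ ξ : Fin k → EuclideanSpace ℝ (Fin n), ∏ i, (𝓕 (f i) (ξ i) * pd (a i) (expo (ξ i)) (y i)) := by
    intro y
    simp only [pd_schwartz_eq_integral]
    exact (integral_fintype_prod_volume_eq_prod (𝕜 := ℂ)
      fun i ξ => 𝓕 (f i) ξ * pd (a i) (expo ξ) (y i)).symm
  rw [rowIntegral]
  simp only [h1]
  rw [integral_integral_swap (integrable_fourier_mul_pd_expo μ a f)]
  refine integral_congr_ae (Filter.Eventually.of_forall fun ξ => ?_)
  simp only [rowIntegral, Finset.prod_mul_distrib]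
  rw [integral_const_mul]

lemma integrable_fourier_mul_rowIntegral (μ : Measure (Fin k → EuclideanSpace ℝ (Fin n)))
    [IsProbabilityMeasure μ] (a : Fin k → List (Fin n))
    (f : Fin k → 𝓢(EuclideanSpace ℝ (Fin n), ℂ)) :
    Integrable fun ξ : Fin k → EuclideanSpace ℝ (Fin n) => (∏ i, 𝓕 (f i) (ξ i)) *
        rowIntegral μ a fun i => expo (ξ i) := by
  refine (integrable_fourier_mul_pd_expo μ a f).integral_prod_right.congr
    (Filter.Eventually.of_forall fun ξ => ?_)
  simp only [rowIntegral, Finset.prod_mul_distrib]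
  rw [integral_const_mul]

/-- A linear relation between row integrals that holds for exponentials holds for Schwartz
functions. -/
lemma sum_rowIntegral_schwartz_eq_zero {ι : Type*} [Fintype ι] (c : ι → ℂ)
    (μ : ι → Measure (Fin k → EuclideanSpace ℝ (Fin n))) [∀ τ, IsProbabilityMeasure (μ τ)]
    (a : ι → Fin k → List (Fin n))
    (h : ∀ ξ : Fin k → EuclideanSpace ℝ (Fin n),
      ∑ τ, c τ * rowIntegral (μ τ) (a τ) (fun i => expo (ξ i)) = 0)
    (f : Fin k → 𝓢(EuclideanSpace ℝ (Fin n), ℂ)) :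
    ∑ τ, c τ * rowIntegral (μ τ) (a τ) (fun i => f i) = 0 := by
  simp only [rowIntegral_schwartz, ← integral_const_mul]
  rw [← integral_finsetSum _ fun τ _ => (integrable_fourier_mul_rowIntegral _ _ f).const_mul _]
  have : ∀ ξ : Fin k → EuclideanSpace ℝ (Fin n), ∑ τ, c τ * ((∏ i, 𝓕 (f i) (ξ i)) *
      rowIntegral (μ τ) (a τ) fun i => expo (ξ i)) = 0 := by
    intro ξ
    rw [← mul_zero (∏ i, 𝓕 (f i) (ξ i)), ← h ξ, Finset.mul_sum]
    exact Finset.sum_congr rfl fun τ _ => by ring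
  simp [this]

end SchwartzRepresentation

/-! ### From Schwartz functions to tame functions by smooth cutoffs. -/

section Cutoff

variable {k n : ℕ}

/-- Families of smooth functions all of whose partial derivatives are of exponential growth,
uniformly in the parameter. -/
def UnifTame (F : ℕ → EuclideanSpace ℝ (Fin n) → ℂ) : Prop :=
  (∀ R, ContDiff ℝ (⊤ : ℕ∞) (F R)) ∧
    ∀ a : List (Fin n), ∃ C c : ℝ, 0 ≤ C ∧ 0 ≤ c ∧ ∀ R x, ‖pd a (F R) x‖ ≤ C * Real.exp (c * ‖x‖)

lemma ExpGrowth.exists_nonneg {f : EuclideanSpace ℝ (Fin n) → ℂ} (hf : ExpGrowth f) :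
    ∃ C c : ℝ, 0 ≤ C ∧ 0 ≤ c ∧ ∀ x, ‖f x‖ ≤ C * Real.exp (c * ‖x‖) := by
  obtain ⟨C, c, h⟩ := hf
  refine ⟨|C|, |c|, abs_nonneg _, abs_nonneg _, fun x => (h x).trans ?_⟩
  gcongr
  · exact le_abs_self C
  · exact le_abs_self c

lemma Tame.unifTame {f : EuclideanSpace ℝ (Fin n) → ℂ} (hf : Tame f) : UnifTame fun _ => f := by
  refine ⟨fun _ => hf.smooth, fun a => ?_⟩
  obtain ⟨C, c, hC, hc, h⟩ := (hf.expGrowth_pd a).exists_nonneg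
  exact ⟨C, c, hC, hc, fun _ => h⟩

lemma UnifTame.lineDeriv {F : ℕ → EuclideanSpace ℝ (Fin n) → ℂ} (hF : UnifTame F) (j : Fin n) :
    UnifTame fun R => pd [j] (F R) := by
  refine ⟨fun R => contDiff_pd (hF.1 R) _, fun a => ?_⟩
  simp only [← pd_append]
  exact hF.2 _

lemma pd_add (a : List (Fin n)) {f g : EuclideanSpace ℝ (Fin n) → ℂ}
    (hf : ContDiff ℝ (⊤ : ℕ∞) f) (hg : ContDiff ℝ (⊤ : ℕ∞) g) :
    pd a (f + g) = pd a f + pd a g := by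
  induction a with
  | nil => rfl
  | cons j a ih =>
    ext x
    simp only [pd_cons, ih, Pi.add_apply]
    exact (((contDiff_pd hf a).differentiable (by simp) x).lineDifferentiableAt.hasLineDerivAt.add
      ((contDiff_pd hg a).differentiable (by simp) x).lineDifferentiableAt.hasLineDerivAt).deriv

lemma pd_singleton_mul (j : Fin n) {f g : EuclideanSpace ℝ (Fin n) → ℂ}
    (hf : ContDiff ℝ (⊤ : ℕ∞) f) (hg : ContDiff ℝ (⊤ : ℕ∞) g) :
    pd [j] (f * g) = pd [j] f * g + f * pd [j] g := by
  ext x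
  simp only [pd_cons, pd_nil, Pi.add_apply, Pi.mul_apply]
  have h1 := (hf.differentiable (by simp) x).lineDifferentiableAt (v := EuclideanSpace.single j 1)
  have h2 := (hg.differentiable (by simp) x).lineDifferentiableAt (v := EuclideanSpace.single j 1)
  rw [_root_.lineDeriv]
  have := deriv_fun_mul h1 h2
  simpa [_root_.lineDeriv] using this

lemma UnifTame.mul {F G : ℕ → EuclideanSpace ℝ (Fin n) → ℂ} (hF : UnifTame F) (hG : UnifTame G) :
    UnifTame fun R => F R * G R := by
  refine ⟨fun R => (hF.1 R).mul (hG.1 R), fun a => ?_⟩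
  -- Peeling off the innermost derivative lets the Leibniz rule act on `F R * G R` itself, and the
  -- induction hypothesis applies to the two resulting products.
  induction a using List.reverseRecOn generalizing F G with
  | nil =>
    obtain ⟨C, c, hC, hc, h⟩ := hF.2 []
    obtain ⟨C', c', hC', hc', h'⟩ := hG.2 []
    refine ⟨C * C', c + c', by positivity, by positivity, fun R x => ?_⟩
    calc ‖pd [] (F R * G R) x‖ = ‖F R x‖ * ‖G R x‖ := norm_mul _ _
      _ ≤ (C * Real.exp (c * ‖x‖)) * (C' * Real.exp (c' * ‖x‖)) := by
        gcongr
        · exact h R x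
        · exact h' R x
      _ = _ := by rw [add_mul, Real.exp_add]; ring
  | append_singleton a j ih =>
    obtain ⟨C, c, hC, hc, h⟩ := ih (hF.lineDeriv j) hG
    obtain ⟨C', c', hC', hc', h'⟩ := ih hF (hG.lineDeriv j)
    refine ⟨C + C', c + c', by positivity, by positivity, fun R x => ?_⟩
    rw [pd_append, pd_singleton_mul j (hF.1 R) (hG.1 R),
      pd_add a (f := pd [j] (F R) * G R) (g := F R * pd [j] (G R)) ((contDiff_pd (hF.1 R) _).mul (hG.1 R)) ((hF.1 R).mul (contDiff_pd (hG.1 R) _))]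
    have e1 : Real.exp (c * ‖x‖) ≤ Real.exp ((c + c') * ‖x‖) := by
      gcongr; linarith
    have e2 : Real.exp (c' * ‖x‖) ≤ Real.exp ((c + c') * ‖x‖) := by
      gcongr; linarith
    refine (norm_add_le _ _).trans ?_
    rw [add_mul]
    exact add_le_add ((h R x).trans (by gcongr)) ((h' R x).trans (by gcongr))

lemma pd_comp_smul (f : EuclideanSpace ℝ (Fin n) → ℂ) (r : ℝ) (a : List (Fin n)) :
    pd a (fun x => f (r • x)) = fun x => (r : ℂ) ^ a.length * pd a f (r • x) := by
  induction a with
  | nil => simp [pd_nil]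
  | cons j a ih =>
    ext x
    simp only [pd_cons, ih, _root_.lineDeriv]
    rw [deriv_const_mul_field]
    have h := deriv_comp_mul_left r
      (fun t : ℝ => pd a f (r • x + t • EuclideanSpace.single j 1)) 0
    have h2 : ∀ t : ℝ, r • (x + t • EuclideanSpace.single j (1 : ℝ)) =
        r • x + (r * t) • EuclideanSpace.single j 1 := fun t => by rw [smul_add, smul_smul]
    simp only [h2, h, mul_zero]
    rw [Complex.real_smul, List.length_cons, pow_succ]
    ring

-- Each derivative brings out a factor `(R + 1)⁻¹ ≤ 1`, and the derivatives of `χ` are bounded, so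
-- the bounds are uniform in `R`.
open scoped SchwartzMap in
lemma unifTame_cutoff {χ : EuclideanSpace ℝ (Fin n) → ℂ} (hχ : ContDiff ℝ (⊤ : ℕ∞) χ)
    (hs : HasCompactSupport χ) : UnifTame fun R x => χ ((R + 1 : ℝ)⁻¹ • x) := by
  refine ⟨fun R => hχ.comp (contDiff_const_smul _), fun a => ?_⟩
  obtain ⟨g, hg, -⟩ := exists_schwartz_pd (hs.toSchwartzMap hχ) a
  obtain ⟨C, hC⟩ := g.decay 0 0
  refine ⟨C, 0, hC.1.le, le_rfl, fun R x => ?_⟩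
  rw [pd_comp_smul, norm_mul, norm_pow]
  have hg' : pd a χ = g := hg
  have h1 : ‖(((R + 1 : ℝ)⁻¹ : ℝ) : ℂ)‖ ^ a.length ≤ 1 := by
    refine pow_le_one₀ (norm_nonneg _) ?_
    rw [Complex.norm_real, norm_inv, Real.norm_of_nonneg (by positivity)]
    exact inv_le_one_of_one_le₀ (by linarith [R.cast_nonneg (α := ℝ)])
  have h2 : ‖pd a χ ((R + 1 : ℝ)⁻¹ • x)‖ ≤ C := by
    rw [hg']; simpa using hC.2 ((R + 1 : ℝ)⁻¹ • x)
  simpa using mul_le_mul h1 h2 (norm_nonneg _) zero_le_one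

lemma pd_congr_of_eventuallyEq {f g : EuclideanSpace ℝ (Fin n) → ℂ} {x : EuclideanSpace ℝ (Fin n)}
    (h : f =ᶠ[nhds x] g) (a : List (Fin n)) : pd a f =ᶠ[nhds x] pd a g := by
  induction a with
  | nil => exact h
  | cons j a ih =>
    filter_upwards [ih.eventuallyEq_nhds] with y hy
    exact hy.lineDeriv_eq

open Filter Topology in
/-- A linear relation between row integrals that holds for exponentials holds for tame functions. -/
theorem sum_rowIntegral_tame_eq_zero {ι : Type*} [Fintype ι] (c : ι → ℂ)
    (μ : ι → Measure (Fin k → EuclideanSpace ℝ (Fin n))) [∀ τ, IsProbabilityMeasure (μ τ)]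
    (hμ : ∀ τ (C : ℝ), Integrable (fun y => Real.exp (C * ∑ i, ‖y i‖)) (μ τ))
    (a : ι → Fin k → List (Fin n))
    (h : ∀ ξ : Fin k → EuclideanSpace ℝ (Fin n),
      ∑ τ, c τ * rowIntegral (μ τ) (a τ) (fun i => expo (ξ i)) = 0)
    {f : Fin k → EuclideanSpace ℝ (Fin n) → ℂ} (hf : ∀ i, Tame (f i)) :
    ∑ τ, c τ * rowIntegral (μ τ) (a τ) f = 0 := by
  let b : ContDiffBump (0 : EuclideanSpace ℝ (Fin n)) := ⟨1, 2, one_pos, one_lt_two⟩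
  let χ : EuclideanSpace ℝ (Fin n) → ℂ := fun x => (b x : ℂ)
  have hχ : ContDiff ℝ (⊤ : ℕ∞) χ := Complex.ofRealCLM.contDiff.comp b.contDiff
  have hχs : HasCompactSupport χ := b.hasCompactSupport.comp_left (g := fun t : ℝ => (t : ℂ)) (by simp)
  let F : Fin k → ℕ → EuclideanSpace ℝ (Fin n) → ℂ :=
    fun i R => (fun x => χ ((R + 1 : ℝ)⁻¹ • x)) * f i
  have hF : ∀ i, UnifTame (F i) := fun i => (unifTame_cutoff hχ hχs).mul (hf i).unifTame
  have hFs : ∀ i R, HasCompactSupport (F i R) := fun i R => by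
    refine HasCompactSupport.mul_right ?_
    exact hχs.comp_smul (inv_ne_zero (by positivity))
  have hzero : ∀ R, ∑ τ, c τ * rowIntegral (μ τ) (a τ) (fun i => F i R) = 0 := fun R =>
    sum_rowIntegral_schwartz_eq_zero c μ a h fun i => (hFs i R).toSchwartzMap ((hF i).1 R)
  -- Once `R` exceeds `‖x‖`, the cutoff equals `1` on a neighbourhood of `x`, so all derivatives at
  -- `x` agree and not only the values.
  have hev : ∀ i x, ∀ᶠ R : ℕ in atTop, F i R =ᶠ[𝓝 x] f i := by
    intro i x
    obtain ⟨N, hN⟩ := exists_nat_gt ‖x‖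
    filter_upwards [eventually_ge_atTop N] with R hR
    have hxR : ‖x‖ < R + 1 := hN.trans_le (by
      have : (N : ℝ) ≤ R := by exact_mod_cast hR
      linarith)
    filter_upwards [(continuous_norm.tendsto x).eventually (eventually_lt_nhds hxR)] with y hy
    have : b ((R + 1 : ℝ)⁻¹ • y) = 1 := by
      refine b.one_of_mem_closedBall ?_
      rw [mem_closedBall_zero_iff, norm_smul, norm_inv, Real.norm_of_nonneg (by positivity)]
      exact (inv_mul_le_one₀ (by positivity)).2 hy.le
    simp [F, χ, this]
  have hlim : ∀ τ, Tendsto (fun R => rowIntegral (μ τ) (a τ) (fun i => F i R)) atTop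
      (𝓝 (rowIntegral (μ τ) (a τ) f)) := by
    intro τ
    choose C c' hC hc' hb using fun i => (hF i).2 (a τ i)
    refine tendsto_integral_of_dominated_convergence
      (fun y => (∏ i, C i) * Real.exp ((∑ i, c' i) * ∑ i, ‖y i‖)) (fun R => ?_)
      ((hμ τ _).const_mul _) (fun R => Eventually.of_forall fun y => ?_)
      (Eventually.of_forall fun y => ?_)
    · refine Continuous.aestronglyMeasurable (continuous_finsetProd _ fun i _ => ?_)
      exact (contDiff_pd ((hF i).1 R) _).continuous.comp (continuous_apply i)
    · rw [norm_prod]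
      calc ∏ i, ‖pd (a τ i) (F i R) (y i)‖ ≤ ∏ i, (C i * Real.exp (c' i * ‖y i‖)) :=
          Finset.prod_le_prod (fun _ _ => norm_nonneg _) fun i _ => hb i R (y i)
        _ = (∏ i, C i) * Real.exp (∑ i, c' i * ‖y i‖) := by
          rw [Finset.prod_mul_distrib, Real.exp_sum]
        _ ≤ _ := by
          have hCn : 0 ≤ ∏ i, C i := Finset.prod_nonneg fun i _ => hC i
          gcongr
          rw [Finset.sum_mul]
          refine Finset.sum_le_sum fun i _ => ?_
          exact mul_le_mul_of_nonneg_left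
            (Finset.single_le_sum (f := fun i => ‖y i‖) (fun _ _ => norm_nonneg _) (Finset.mem_univ i))
            (hc' i)
    · refine tendsto_finsetProd _ fun i _ => ?_
      refine tendsto_const_nhds.congr' ?_
      filter_upwards [hev i (y i)] with R hR
      exact (pd_congr_of_eventuallyEq hR (a τ i)).self_of_nhds.symm
  have hlim' : Tendsto (fun R => ∑ τ, c τ * rowIntegral (μ τ) (a τ) (fun i => F i R)) atTop
      (𝓝 (∑ τ, c τ * rowIntegral (μ τ) (a τ) f)) :=
    tendsto_finsetSum _ fun τ _ => (hlim τ).const_mul (c τ)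
  simp only [hzero] at hlim'
  exact (tendsto_nhds_unique hlim' tendsto_const_nhds)

end Cutoff

end TreeCumulant

namespace TreeCumulant

/-! ### Gaussian characteristic functions and exponential moments. -/

section Gaussian

variable {Ω : Type*} [MeasurableSpace Ω] {P : Measure Ω}

lemma map_eq_pi [IsProbabilityMeasure P] {ι : Type*} [Fintype ι] {W : ι → Ω → ℝ} {ν : Measure ℝ} [SigmaFinite ν]
    (hW : iIndepFun W P) (hl : ∀ p, HasLaw (W p) ν P) :
    P.map (fun ω p => W p ω) = Measure.pi fun _ => ν := by
  rw [(iIndepFun_iff_map_fun_eq_pi_map fun p => (hl p).aemeasurable).1 hW]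
  congr 1
  ext1 p
  exact (hl p).map_eq

lemma aemeasurable_pi_of_hasLaw {ι : Type*} [Fintype ι] {W : ι → Ω → ℝ} {ν : Measure ℝ}
    (hl : ∀ p, HasLaw (W p) ν P) : AEMeasurable (fun ω p => W p ω) P :=
  aemeasurable_pi_lambda _ fun p => (hl p).aemeasurable

lemma integral_exp_gaussian [IsProbabilityMeasure P] {ι : Type*} [Fintype ι] {W : ι → Ω → ℝ}
    (hW : iIndepFun W P) (hl : ∀ p, HasLaw (W p) (gaussianReal 0 1) P) (c : ι → ℝ) :
    ∫ ω, Complex.exp ((∑ p, c p * W p ω : ℝ) * Complex.I) ∂P =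
      Complex.exp ((-(∑ p, c p ^ 2) / 2 : ℝ)) := by
  have hm := aemeasurable_pi_of_hasLaw hl
  have h1 : ∫ ω, Complex.exp ((∑ p, c p * W p ω : ℝ) * Complex.I) ∂P =
      ∫ w : ι → ℝ, ∏ p, Complex.exp ((c p : ℂ) * (w p : ℂ) * Complex.I)
        ∂(Measure.pi fun _ => gaussianReal 0 1) := by
    rw [← map_eq_pi hW hl, integral_map hm
      (by exact Continuous.aestronglyMeasurable (by fun_prop))]
    refine integral_congr_ae (Filter.Eventually.of_forall fun ω => ?_)
    simp only
    rw [← Complex.exp_sum, ← Finset.sum_mul]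
    push_cast
    rfl
  rw [h1, integral_fintype_prod_eq_prod (𝕜 := ℂ)
    (f := fun p (t : ℝ) => Complex.exp ((c p : ℂ) * (t : ℂ) * Complex.I))]
  have h2 : ∀ p, ∫ t, Complex.exp ((c p : ℂ) * (t : ℂ) * Complex.I) ∂(gaussianReal 0 1) =
      Complex.exp (-(c p : ℂ) ^ 2 / 2) := by
    intro p
    rw [← charFun_apply_real, charFun_gaussianReal]
    congr 1
    simp
    ring
  simp only [h2]
  rw [← Complex.exp_sum]
  congr 1
  push_cast
  rw [neg_div, Finset.sum_div, ← Finset.sum_neg_distrib]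
  exact Finset.sum_congr rfl fun p _ => by ring

lemma integrable_exp_mul_abs_gaussian (K : ℝ) :
    Integrable (fun t => Real.exp (K * |t|)) (gaussianReal 0 1) := by
  refine ((integrable_exp_mul_gaussianReal K).add (integrable_exp_mul_gaussianReal (-K))).mono'
    (Continuous.aestronglyMeasurable (by fun_prop)) (Filter.Eventually.of_forall fun t => ?_)
  rw [Real.norm_of_nonneg (Real.exp_pos _).le, Pi.add_apply]
  rcases abs_choice t with h | h <;> rw [h]
  · exact le_add_of_nonneg_right (Real.exp_pos _).le
  · rw [mul_neg, ← neg_mul]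
    exact le_add_of_nonneg_left (Real.exp_pos _).le

lemma integrable_exp_sum_abs_gaussian [IsProbabilityMeasure P] {ι : Type*} [Fintype ι] {W : ι → Ω → ℝ}
    (hW : iIndepFun W P) (hl : ∀ p, HasLaw (W p) (gaussianReal 0 1) P) (K : ℝ) :
    Integrable (fun ω => Real.exp (K * ∑ p, |W p ω|)) P := by
  have hm := aemeasurable_pi_of_hasLaw hl
  have h1 : Integrable (fun w : ι → ℝ => ∏ p, Real.exp (K * |w p|))
      (Measure.pi fun _ => gaussianReal 0 1) :=
    Integrable.fintype_prod (𝕜 := ℝ) (f := fun _ (t : ℝ) => Real.exp (K * |t|))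
      fun _ => integrable_exp_mul_abs_gaussian K
  rw [← map_eq_pi hW hl] at h1
  refine (h1.comp_aemeasurable hm).congr (Filter.Eventually.of_forall fun ω => ?_)
  simp only [Function.comp]
  rw [← Real.exp_sum, Finset.mul_sum]

lemma norm_le_sum_abs {n : ℕ} (y : EuclideanSpace ℝ (Fin n)) : ‖y‖ ≤ ∑ j, |y j| := by
  conv_lhs => rw [← (EuclideanSpace.basisFun (Fin n) ℝ).sum_repr y]
  refine (norm_sum_le _ _).trans (Finset.sum_le_sum fun j _ => ?_)
  simp [norm_smul]

variable {n : ℕ} {ζ : Ω → EuclideanSpace ℝ (Fin n)}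

lemma aemeasurable_of_coords (hζ_law : ∀ j : Fin n, HasLaw (fun ω => ζ ω j) (gaussianReal 0 1) P) :
    AEMeasurable ζ P := by
  have h := aemeasurable_pi_of_hasLaw hζ_law
  exact (PiLp.continuous_toLp 2 _).measurable.comp_aemeasurable h

lemma integrable_exp_norm_gaussian [IsProbabilityMeasure P]
    (hζ_indep : iIndepFun (fun (j : Fin n) (ω : Ω) => ζ ω j) P)
    (hζ_law : ∀ j : Fin n, HasLaw (fun ω => ζ ω j) (gaussianReal 0 1) P) (K : ℝ) :
    Integrable (fun ω => Real.exp (K * ‖ζ ω‖)) P := by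
  refine (integrable_exp_sum_abs_gaussian hζ_indep hζ_law |K|).mono'
    ((by fun_prop : Measurable fun y : EuclideanSpace ℝ (Fin n) =>
      Real.exp (K * ‖y‖)).comp_aemeasurable (aemeasurable_of_coords hζ_law)).aestronglyMeasurable
    (Filter.Eventually.of_forall fun ω => ?_)
  rw [Real.norm_of_nonneg (Real.exp_pos _).le, Real.exp_le_exp]
  exact mul_le_mul (le_abs_self K) (norm_le_sum_abs _) (norm_nonneg _) (abs_nonneg _)

lemma integral_expo_gaussian [IsProbabilityMeasure P]
    (hζ_indep : iIndepFun (fun (j : Fin n) (ω : Ω) => ζ ω j) P)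
    (hζ_law : ∀ j : Fin n, HasLaw (fun ω => ζ ω j) (gaussianReal 0 1) P)
    (ξ : EuclideanSpace ℝ (Fin n)) :
    ∫ ω, expo ξ (ζ ω) ∂P = Complex.exp ((-(4 * Real.pi ^ 2 * ‖ξ‖ ^ 2) / 2 : ℝ)) := by
  have h := integral_exp_gaussian hζ_indep hζ_law fun j => 2 * Real.pi * ξ j
  have h1 : ∑ j, (2 * Real.pi * ξ j) ^ 2 = 4 * Real.pi ^ 2 * ‖ξ‖ ^ 2 := by
    rw [EuclideanSpace.norm_sq_eq, Finset.mul_sum]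
    refine Finset.sum_congr rfl fun j _ => ?_
    rw [Real.norm_eq_abs, sq_abs]; ring
  rw [h1] at h
  rw [← h]
  refine integral_congr_ae (Filter.Eventually.of_forall fun ω => ?_)
  simp only [expo, PiLp.inner_apply, Finset.mul_sum]
  congr 4
  ext j
  simp
  ring

end Gaussian

section SymmetricSums

/-- Each pair is met in two orders; the resulting `2` cancels the one half in Gaussian exponents. -/
lemma sum_sum_sym2 {k : ℕ} (h : Sym2 (Fin k) → ℂ) :
    ∑ i, ∑ j, h s(i, j) = ∑ i, h s(i, i) + 2 * ∑ e ∈ nonDiag (Fin k), h e := by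
  classical
  have h1 : ∑ e ∈ nonDiag (Fin k), h e =
      ∑ p ∈ (Finset.univ : Finset (Fin k)).offDiag with p.1 < p.2, h s(p.1, p.2) := by
    rw [← Finset.sum_sym2_filter_not_isDiag]
    refine Finset.sum_congr ?_ fun _ _ => rfl
    ext e; simp [mem_nonDiag]
  have h2 : ∑ p ∈ (Finset.univ : Finset (Fin k)).offDiag with ¬ p.1 < p.2, h s(p.1, p.2) =
      ∑ p ∈ (Finset.univ : Finset (Fin k)).offDiag with p.1 < p.2, h s(p.1, p.2) := by
    refine Finset.sum_bij' (fun p _ => p.swap) (fun p _ => p.swap) ?_ ?_ (by simp) (by simp) ?_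
    · intro p hp
      simp only [Finset.mem_filter, Finset.mem_offDiag, Finset.mem_univ, true_and] at hp ⊢
      exact ⟨Ne.symm hp.1, lt_of_le_of_ne (not_lt.1 hp.2) (Ne.symm hp.1)⟩
    · intro p hp
      simp only [Finset.mem_filter, Finset.mem_offDiag, Finset.mem_univ, true_and] at hp ⊢
      exact ⟨Ne.symm hp.1, not_lt.2 hp.2.le⟩
    · intro p _
      rw [Sym2.eq_swap]; rfl
  rw [← Fintype.sum_prod_type', ← Finset.univ_product_univ, ← Finset.diag_union_offDiag,
    Finset.sum_union (Finset.disjoint_diag_offDiag _), Finset.sum_diag,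
    ← Finset.sum_filter_add_sum_filter_not _ (fun p : Fin k × Fin k => p.1 < p.2), h2, ← h1]
  ring

end SymmetricSums

end TreeCumulant

namespace TreeCumulant

/-! ### Matrices as families of rows; bounds for tame products. -/

section Rows

variable {k n : ℕ}

/-- The rows of a matrix, as points of Euclidean space. -/
def rows (M : Matrix (Fin k) (Fin n) ℝ) : Fin k → EuclideanSpace ℝ (Fin n) :=
  fun i => WithLp.toLp 2 (M i)

lemma measurable_rows : Measurable (rows (k := k) (n := n)) := by
  refine measurable_pi_lambda _ fun i => ?_
  exact (PiLp.continuous_toLp 2 _).measurable.comp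
    (measurable_pi_apply i : Measurable fun M : Fin k → Fin n → ℝ => M i)

lemma measurable_matrix_mul : Measurable fun p : Matrix (Fin k) (Fin k) ℝ × Matrix (Fin k) (Fin n) ℝ =>
    p.1 * p.2 := by
  have h1 : ∀ i j, Measurable fun M : Matrix (Fin k) (Fin k) ℝ => M i j := fun i j =>
    (measurable_pi_apply j).comp (measurable_pi_apply i)
  have h2 : ∀ i j, Measurable fun M : Matrix (Fin k) (Fin n) ℝ => M i j := fun i j =>
    (measurable_pi_apply j).comp (measurable_pi_apply i)
  refine measurable_pi_lambda _ fun i => measurable_pi_lambda _ fun j => ?_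
  simp only [Matrix.mul_apply]
  exact Finset.measurable_fun_sum _ fun l _ =>
    ((h1 i l).comp measurable_fst).mul ((h2 l j).comp measurable_snd)

lemma tame_expo (ξ : EuclideanSpace ℝ (Fin n)) : Tame (expo ξ) where
  smooth := contDiff_expo ξ
  growth m s := by
    refine ⟨‖((List.ofFn s).map (symb ξ)).prod‖, 0, fun x => ?_⟩
    have h := pd_eq_iteratedFDeriv (contDiff_expo ξ) (List.ofFn s) x
    have h2 : (iteratedFDeriv ℝ (List.ofFn s).length (expo ξ) x fun r =>
        EuclideanSpace.single ((List.ofFn s).get r) (1 : ℝ)) =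
        iteratedFDeriv ℝ m (expo ξ) x fun r => EuclideanSpace.single (s r) (1 : ℝ) := by
      -- The length of `List.ofFn s` is not syntactically `m`; with `l` a variable, the equation can
      -- be substituted.
      have : ∀ (l : ℕ) (hl : l = m) (t : Fin l → Fin n), (∀ r, t r = s (Fin.cast hl r)) →
          (iteratedFDeriv ℝ l (expo ξ) x fun r => EuclideanSpace.single (t r) (1 : ℝ)) =
          iteratedFDeriv ℝ m (expo ξ) x fun r => EuclideanSpace.single (s r) (1 : ℝ) := by
        rintro l rfl t ht
        congr 1
        ext1 r
        rw [ht r]; rfl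
      exact this _ (List.length_ofFn) _ fun r => by simp; rfl
    change ‖iteratedFDeriv ℝ m (expo ξ) x fun r => EuclideanSpace.single (s r) (1 : ℝ)‖ ≤ _
    rw [← h2, ← h, pd_expo, norm_mul, norm_expo]
    simp

lemma Tame.exists_norm_prod_le {f : Fin k → EuclideanSpace ℝ (Fin n) → ℂ} (hf : ∀ i, Tame (f i))
    (a : Fin k → List (Fin n)) : ∃ C c : ℝ, 0 ≤ c ∧ ∀ y : Fin k → EuclideanSpace ℝ (Fin n),
      ‖∏ i, pd (a i) (f i) (y i)‖ ≤ C * Real.exp (c * ∑ i, ‖y i‖) := by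
  choose C c hC hc hb using fun i => ((hf i).expGrowth_pd (a i)).exists_nonneg
  refine ⟨∏ i, C i, ∑ i, c i, Finset.sum_nonneg fun i _ => hc i, fun y => ?_⟩
  rw [norm_prod]
  calc ∏ i, ‖pd (a i) (f i) (y i)‖ ≤ ∏ i, (C i * Real.exp (c i * ‖y i‖)) :=
      Finset.prod_le_prod (fun _ _ => norm_nonneg _) fun i _ => hb i (y i)
    _ = (∏ i, C i) * Real.exp (∑ i, c i * ‖y i‖) := by
      rw [Finset.prod_mul_distrib, Real.exp_sum]
    _ ≤ _ := by
      have hCn : 0 ≤ ∏ i, C i := Finset.prod_nonneg fun i _ => hC i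
      gcongr
      rw [Finset.sum_mul]
      refine Finset.sum_le_sum fun i _ => ?_
      exact mul_le_mul_of_nonneg_left
        (Finset.single_le_sum (f := fun i => ‖y i‖) (fun _ _ => norm_nonneg _) (Finset.mem_univ i))
        (hc i)

lemma continuous_prod_pd {f : Fin k → EuclideanSpace ℝ (Fin n) → ℂ} (hf : ∀ i, Tame (f i))
    (a : Fin k → List (Fin n)) :
    Continuous fun y : Fin k → EuclideanSpace ℝ (Fin n) => ∏ i, pd (a i) (f i) (y i) :=
  continuous_finsetProd _ fun i _ =>
    (contDiff_pd (hf i).smooth _).continuous.comp (continuous_apply i)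

lemma integrable_prod_pd {μ : Measure (Fin k → EuclideanSpace ℝ (Fin n))}
    (hμ : ∀ C : ℝ, Integrable (fun y => Real.exp (C * ∑ i, ‖y i‖)) μ)
    {f : Fin k → EuclideanSpace ℝ (Fin n) → ℂ} (hf : ∀ i, Tame (f i)) (a : Fin k → List (Fin n)) :
    Integrable (fun y => ∏ i, pd (a i) (f i) (y i)) μ := by
  obtain ⟨C, c, -, hb⟩ := Tame.exists_norm_prod_le hf a
  exact ((hμ c).const_mul C).mono' (continuous_prod_pd hf a).aestronglyMeasurable
    (Filter.Eventually.of_forall hb)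

end Rows

/-! ### Gaussian matrices with random weights. -/

section RandomWeights

variable {k n : ℕ}

lemma sum_inner_mul_rows (S : Fin k → Fin k → ℝ) (z : Fin k → Fin n → ℝ) (ξ : Fin k → Fin n → ℝ)
    (c : ℝ) : ∑ i, c * ∑ j, (∑ l, S i l * z l j) * ξ i j =
      ∑ l, ∑ j, (c * ∑ i, ξ i j * S i l) * z l j := by
  simp only [Finset.mul_sum, Finset.sum_mul]
  rw [Finset.sum_comm]
  conv_rhs => rw [Finset.sum_comm]
  refine Finset.sum_congr rfl fun j _ => ?_
  rw [Finset.sum_comm]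
  exact Finset.sum_congr rfl fun l _ => Finset.sum_congr rfl fun i _ => by ring

/-- The variance of $\sum_i c\langle\xi_i,(SZ)_i\rangle$ depends on $S$ only through $SS^{\mathsf
T}$, which is `A` when `S` is its square root. -/
lemma sum_sq_sum_mul (S : Fin k → Fin k → ℝ) (ξ : Fin k → Fin n → ℝ) (c : ℝ) :
    ∑ l, ∑ j, (c * ∑ i, ξ i j * S i l) ^ 2 =
      ∑ i, ∑ i', c ^ 2 * (∑ j, ξ i' j * ξ i j) * ∑ l, S i l * S i' l := by
  simp only [pow_two, Finset.mul_sum, Finset.sum_mul]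
  have h : ∀ F : Fin k → Fin n → Fin k → Fin k → ℝ,
      ∑ l, ∑ j, ∑ i, ∑ i', F l j i i' = ∑ i, ∑ i', ∑ l, ∑ j, F l j i i' := by
    intro F
    simp only [← Fintype.sum_prod_type' (f := fun l j => _)]
    exact Fintype.sum_equiv ⟨fun x => (x.2.2.1, x.2.2.2, x.1, x.2.1),
      fun x => (x.2.2.1, x.2.2.2, x.1, x.2.1), fun _ => rfl, fun _ => rfl⟩ _ _ fun _ => rfl
  rw [h]
  refine Finset.sum_congr rfl fun i _ => Finset.sum_congr rfl fun i' _ =>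
    Finset.sum_congr rfl fun l _ => Finset.sum_congr rfl fun j _ => by ring

variable {Ω : Type*} [MeasurableSpace Ω] {P : Measure Ω} {wt : Ω → Matrix (Fin k) (Fin k) ℝ}
  {Z : Ω → Matrix (Fin k) (Fin n) ℝ}

lemma aemeasurable_matrix
    (hZ_law : ∀ p : Fin k × Fin n, HasLaw (fun ω => Z ω p.1 p.2) (gaussianReal 0 1) P) :
    AEMeasurable Z P := by
  refine aemeasurable_pi_lambda (fun ω i => Z ω i) fun i => aemeasurable_pi_lambda _ fun j => ?_
  exact (hZ_law (i, j)).aemeasurable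

lemma aemeasurable_sqrt_mul (hw : AEMeasurable wt P) (hZ : AEMeasurable Z P) :
    AEMeasurable (fun ω => rows (matrixSqrt (wt ω) * Z ω)) P :=
  measurable_rows.comp_aemeasurable (measurable_matrix_mul.comp_aemeasurable
    ((measurable_matrixSqrt.comp_aemeasurable hw).prodMk hZ))

variable [IsProbabilityMeasure P] {T : SimpleGraph (Fin k)} [Fintype T.edgeSet] {x : T.edgeSet → Ω → ℝ}

lemma ae_wt_eq (hT : T.IsTree) (hx_indep : iIndepFun x P) (hx_law : ∀ e, HasLaw (x e) unif P)
    (hwt : ∀ᵐ ω ∂P, wt ω = weightMatrix T fun e => x e ω) :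
    ∀ᵐ ω ∂P, (∀ e, x e ω ∈ Set.Ioo (0 : ℝ) 1) ∧
      wt ω = sepMatrix T (extendZero fun e => x e ω) := by
  have hm := aemeasurable_pi_of_hasLaw hx_law
  have h1 : ∀ᵐ ω ∂P, ∀ e, x e ω ∈ Set.Ioo (0 : ℝ) 1 := by
    have := ae_mem_pi_unif T.edgeSet
    rw [← map_eq_pi hx_indep hx_law] at this
    exact ae_of_ae_map hm this
  have h2 : ∀ᵐ ω ∂P, Function.Injective fun e => x e ω := by
    have := ae_injective_pi_unif T.edgeSet
    rw [← map_eq_pi hx_indep hx_law] at this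
    exact ae_of_ae_map hm this
  filter_upwards [h1, h2, hwt] with ω hω1 hω2 hω3
  exact ⟨hω1, by rw [hω3, weightMatrix_eq hT hω1 hω2]⟩

lemma measurable_extendZero {ι : Type*} {S : Set ι} :
    Measurable fun p : S → ℝ => (extendZero p : ι → ℝ) := by
  refine measurable_pi_lambda _ fun e => ?_
  unfold extendZero
  split_ifs with he
  · exact measurable_pi_apply _
  · exact measurable_const

lemma measurable_sepMatrix_extendZero (T : SimpleGraph (Fin k)) :
    Measurable fun p : T.edgeSet → ℝ => sepMatrix T (extendZero p) :=
  measurable_pi_lambda _ fun i => measurable_pi_lambda _ fun j =>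
    (measurable_sepMin T s(i, j)).comp measurable_extendZero

lemma aemeasurable_wt (hT : T.IsTree) (hx_indep : iIndepFun x P)
    (hx_law : ∀ e, HasLaw (x e) unif P)
    (hwt : ∀ᵐ ω ∂P, wt ω = weightMatrix T fun e => x e ω) : AEMeasurable wt P := by
  refine ((measurable_sepMatrix_extendZero T).comp_aemeasurable
    (aemeasurable_pi_of_hasLaw hx_law)).congr ?_
  filter_upwards [ae_wt_eq hT hx_indep hx_law hwt] with ω hω
  exact hω.2.symm

lemma ae_wt_posSemidef (hT : T.IsTree) (hx_indep : iIndepFun x P)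
    (hx_law : ∀ e, HasLaw (x e) unif P)
    (hwt : ∀ᵐ ω ∂P, wt ω = weightMatrix T fun e => x e ω) :
    ∀ᵐ ω ∂P, (wt ω).PosSemidef ∧ ∀ i, wt ω i i = 1 := by
  filter_upwards [ae_wt_eq hT hx_indep hx_law hwt] with ω hω
  have h := isCoUltrametric_sepMatrix hT (extendZero_pos hω.1)
  rw [hω.2]
  exact ⟨h.posSemidef, h.diag⟩

lemma sum_norm_rows_le {S : Matrix (Fin k) (Fin k) ℝ} (hS : ∀ i j, |S i j| ≤ 1)
    (M : Matrix (Fin k) (Fin n) ℝ) :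
    ∑ i, ‖rows (S * M) i‖ ≤ k * ∑ p : Fin k × Fin n, |M p.1 p.2| := by
  have h : ∀ i, ‖rows (S * M) i‖ ≤ ∑ p : Fin k × Fin n, |M p.1 p.2| := by
    intro i
    refine (norm_le_sum_abs _).trans ?_
    rw [Fintype.sum_prod_type_right]
    refine Finset.sum_le_sum fun j _ => ?_
    change |(S * M) i j| ≤ _
    rw [Matrix.mul_apply]
    refine (Finset.abs_sum_le_sum_abs _ _).trans (Finset.sum_le_sum fun l _ => ?_)
    rw [abs_mul]
    exact mul_le_of_le_one_left (abs_nonneg _) (hS i l)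
  refine (Finset.sum_le_sum fun i _ => h i).trans ?_
  simp

lemma integrable_exp_rows (hw : AEMeasurable wt P)
    (hpsd : ∀ᵐ ω ∂P, (wt ω).PosSemidef ∧ ∀ i, wt ω i i = 1)
    (hZ_indep : iIndepFun (fun (p : Fin k × Fin n) (ω : Ω) => Z ω p.1 p.2) P)
    (hZ_law : ∀ p : Fin k × Fin n, HasLaw (fun ω => Z ω p.1 p.2) (gaussianReal 0 1) P) (C : ℝ) :
    Integrable (fun y => Real.exp (C * ∑ i, ‖y i‖))
      (P.map fun ω => rows (matrixSqrt (wt ω) * Z ω)) := by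
  have hm := aemeasurable_sqrt_mul hw (aemeasurable_matrix hZ_law)
  have hc : Continuous fun y : Fin k → EuclideanSpace ℝ (Fin n) => Real.exp (C * ∑ i, ‖y i‖) := by
    fun_prop
  rw [integrable_map_measure hc.aestronglyMeasurable hm]
  refine (integrable_exp_sum_abs_gaussian hZ_indep hZ_law (|C| * k)).mono'
    (hc.measurable.comp_aemeasurable hm).aestronglyMeasurable ?_
  filter_upwards [hpsd] with ω hω
  simp only [Function.comp]
  rw [Real.norm_of_nonneg (Real.exp_pos _).le, Real.exp_le_exp, mul_assoc]
  exact mul_le_mul (le_abs_self C)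
    (sum_norm_rows_le (abs_matrixSqrt_le_one hω.1 hω.2) _)
    (Finset.sum_nonneg fun _ _ => norm_nonneg _) (abs_nonneg _)

lemma integral_tensorProd_expo_const (hZ_indep : iIndepFun (fun (p : Fin k × Fin n) (ω : Ω) => Z ω p.1 p.2) P)
    (hZ_law : ∀ p : Fin k × Fin n, HasLaw (fun ω => Z ω p.1 p.2) (gaussianReal 0 1) P)
    (ξ : Fin k → EuclideanSpace ℝ (Fin n)) {A : Matrix (Fin k) (Fin k) ℝ} (hA : A.PosSemidef) :
    ∫ ω, tensorProd (fun i => expo (ξ i)) (matrixSqrt A * Z ω) ∂P =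
      Complex.exp (∑ i, ∑ j, gramLabel ξ s(i, j) * A i j / 2) := by
  have h := integral_exp_gaussian hZ_indep hZ_law fun p =>
    2 * Real.pi * ∑ i, ξ i p.2 * matrixSqrt A i p.1
  have h1 : ∀ ω, tensorProd (fun i => expo (ξ i)) (matrixSqrt A * Z ω) =
      Complex.exp ((∑ p : Fin k × Fin n, (2 * Real.pi * ∑ i, ξ i p.2 * matrixSqrt A i p.1) *
        Z ω p.1 p.2 : ℝ) * Complex.I) := by
    intro ω
    simp only [tensorProd, expo]
    rw [← Complex.exp_sum, ← Finset.sum_mul]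
    congr 2
    rw [← Complex.ofReal_sum]
    congr 1
    rw [Fintype.sum_prod_type, ← sum_inner_mul_rows (matrixSqrt A) (Z ω) fun i => ξ i]
    simp only [PiLp.inner_apply, Matrix.mul_apply]
    rfl
  simp only [h1, h]
  congr 1
  have h2 : ∑ p : Fin k × Fin n, (2 * Real.pi * ∑ i, ξ i p.2 * matrixSqrt A i p.1) ^ 2 =
      ∑ i, ∑ j, 4 * Real.pi ^ 2 * inner ℝ (ξ i) (ξ j) * A i j := by
    rw [Fintype.sum_prod_type, sum_sq_sum_mul (matrixSqrt A) fun i => ξ i]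
    simp only [sum_matrixSqrt_mul hA, PiLp.inner_apply, mul_pow]
    norm_num
  rw [h2]
  push_cast
  rw [neg_div, Finset.sum_div, ← Finset.sum_neg_distrib]
  refine Finset.sum_congr rfl fun i _ => ?_
  rw [Finset.sum_div, ← Finset.sum_neg_distrib]
  refine Finset.sum_congr rfl fun j _ => ?_
  rw [gramLabel_mk]
  push_cast
  ring

lemma measurable_tensorProd_expo (ξ : Fin k → EuclideanSpace ℝ (Fin n)) :
    Measurable (tensorProd fun i => expo (ξ i)) := by
  refine Finset.measurable_fun_prod _ fun i _ => ?_
  exact (contDiff_expo (ξ i)).continuous.measurable.comp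
    ((measurable_pi_apply i).comp measurable_rows)

/-- By independence, `Z` may be integrated first with the weights frozen, and then the
characteristic function applies. -/
lemma integral_tensorProd_expo (hw : AEMeasurable wt P)
    (hpsd : ∀ᵐ ω ∂P, (wt ω).PosSemidef ∧ ∀ i, wt ω i i = 1)
    (hZ_indep : iIndepFun (fun (p : Fin k × Fin n) (ω : Ω) => Z ω p.1 p.2) P)
    (hZ_law : ∀ p : Fin k × Fin n, HasLaw (fun ω => Z ω p.1 p.2) (gaussianReal 0 1) P)
    (hwtZ : IndepFun wt Z P) (ξ : Fin k → EuclideanSpace ℝ (Fin n)) :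
    ∫ ω, tensorProd (fun i => expo (ξ i)) (matrixSqrt (wt ω) * Z ω) ∂P =
      ∫ ω, Complex.exp (∑ i, ∑ j, gramLabel ξ s(i, j) * wt ω i j / 2) ∂P := by
  have hZ := aemeasurable_matrix hZ_law
  have hg : Measurable fun p : Matrix (Fin k) (Fin k) ℝ × Matrix (Fin k) (Fin n) ℝ =>
      tensorProd (fun i => expo (ξ i)) (matrixSqrt p.1 * p.2) :=
    (measurable_tensorProd_expo ξ).comp (measurable_matrix_mul.comp
      ((measurable_matrixSqrt.comp measurable_fst).prodMk measurable_snd))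
  have hmap := (indepFun_iff_map_prod_eq_prod_map_map hw hZ).1 hwtZ
  have := Measure.isProbabilityMeasure_map hw (μ := P)
  have := Measure.isProbabilityMeasure_map hZ (μ := P)
  have h1 : ∫ ω, tensorProd (fun i => expo (ξ i)) (matrixSqrt (wt ω) * Z ω) ∂P =
      ∫ A, ∫ M, tensorProd (fun i => expo (ξ i)) (matrixSqrt A * M) ∂(P.map Z) ∂(P.map wt) := by
    rw [← integral_prod (fun p : Matrix (Fin k) (Fin k) ℝ × Matrix (Fin k) (Fin n) ℝ =>
      tensorProd (fun i => expo (ξ i)) (matrixSqrt p.1 * p.2)), ← hmap,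
      integral_map (hw.prodMk hZ) hg.aestronglyMeasurable]
    refine Integrable.of_bound hg.aestronglyMeasurable 1 (Filter.Eventually.of_forall fun p => ?_)
    rw [tensorProd, norm_prod]
    simp [norm_expo]
  have h2 : ∀ A, ∫ M, tensorProd (fun i => expo (ξ i)) (matrixSqrt A * M) ∂(P.map Z) =
      ∫ ω, tensorProd (fun i => expo (ξ i)) (matrixSqrt A * Z ω) ∂P := by
    intro A
    exact integral_map hZ (hg.comp (measurable_const.prodMk measurable_id)).aestronglyMeasurable
  rw [h1, integral_map hw]
  · refine integral_congr_ae ?_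
    filter_upwards [hpsd] with ω hω
    exact (h2 _).trans <| integral_tensorProd_expo_const hZ_indep hZ_law ξ hω.1
  · exact hg.stronglyMeasurable.integral_prod_right.aestronglyMeasurable

end RandomWeights

end TreeCumulant

namespace TreeCumulant

/-! ### Products of moments as integrals against block laws. -/

section Blocks

variable {k n d : ℕ}

/-- The law of a family of rows that are equal on each fibre of `p` and independent, of law `ν`,
across the fibres. -/
noncomputable def blockMeasure (p : Fin k → Fin d) (ν : Measure (EuclideanSpace ℝ (Fin n))) :
    Measure (Fin k → EuclideanSpace ℝ (Fin n)) :=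
  (Measure.pi fun _ : Fin d => ν).map fun z i => z (p i)

lemma measurable_comp_index (p : Fin k → Fin d) :
    Measurable fun (z : Fin d → EuclideanSpace ℝ (Fin n)) (i : Fin k) => z (p i) :=
  measurable_pi_lambda _ fun _ => measurable_pi_apply _

instance (p : Fin k → Fin d) (ν : Measure (EuclideanSpace ℝ (Fin n))) [IsProbabilityMeasure ν] :
    IsProbabilityMeasure (blockMeasure p ν) :=
  Measure.isProbabilityMeasure_map (measurable_comp_index p).aemeasurable

/-- This makes a product of moments a single integral of $f_1\otimes\cdots\otimes f_k$, so that
cumulants fall under the extension argument for row integrals. -/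
lemma rowIntegral_blockMeasure (p : Fin k → Fin d) (ν : Measure (EuclideanSpace ℝ (Fin n)))
    [IsProbabilityMeasure ν] {f : Fin k → EuclideanSpace ℝ (Fin n) → ℂ}
    (hf : ∀ i, Continuous (f i)) :
    rowIntegral (blockMeasure p ν) (fun _ => []) f = ∏ j, ∫ y, ∏ i with p i = j, f i y ∂ν := by
  have hc : Continuous fun y : Fin k → EuclideanSpace ℝ (Fin n) => ∏ i, f i (y i) :=
    continuous_finsetProd _ fun i _ => (hf i).comp (continuous_apply i)
  simp only [rowIntegral, pd_nil]
  rw [blockMeasure, integral_map (measurable_comp_index p).aemeasurable hc.aestronglyMeasurable,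
    ← integral_fintype_prod_eq_prod (𝕜 := ℂ) (f := fun j y => ∏ i with p i = j, f i y)]
  refine integral_congr_ae (Filter.Eventually.of_forall fun z => ?_)
  simp only
  rw [← Finset.prod_fiberwise _ p]
  refine Finset.prod_congr rfl fun j _ => Finset.prod_congr rfl fun i hi => ?_
  rw [(Finset.mem_filter.1 hi).2]

lemma integrable_exp_blockMeasure (p : Fin k → Fin d) {ν : Measure (EuclideanSpace ℝ (Fin n))}
    [IsProbabilityMeasure ν] (hν : ∀ C : ℝ, Integrable (fun y => Real.exp (C * ‖y‖)) ν) (C : ℝ) :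
    Integrable (fun y => Real.exp (C * ∑ i, ‖y i‖)) (blockMeasure p ν) := by
  have hc : Continuous fun y : Fin k → EuclideanSpace ℝ (Fin n) => Real.exp (C * ∑ i, ‖y i‖) := by
    fun_prop
  rw [blockMeasure, integrable_map_measure hc.aestronglyMeasurable
    (measurable_comp_index p).aemeasurable]
  refine (Integrable.fintype_prod (𝕜 := ℝ)
    (f := fun j y => Real.exp ((Finset.card {i | p i = j} * C) * ‖y‖)) fun j => hν _).congr
    (Filter.Eventually.of_forall fun z => ?_)
  simp only [Function.comp]
  rw [← Real.exp_sum, ← Finset.sum_fiberwise _ p, Finset.mul_sum]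
  congr 1
  refine Finset.sum_congr rfl fun j _ => ?_
  have : ∑ i with p i = j, ‖z (p i)‖ = ∑ i with p i = j, ‖z j‖ :=
    Finset.sum_congr rfl fun i hi => by rw [(Finset.mem_filter.1 hi).2]
  rw [this, Finset.sum_const, nsmul_eq_mul]
  ring

end Blocks

/-! ### The theorem for characters. -/

section CumulantOfExponentials

variable {Ω : Type*} [MeasurableSpace Ω] {P : Measure Ω} [IsProbabilityMeasure P] {k n : ℕ}
  {ζ : Ω → EuclideanSpace ℝ (Fin n)}

lemma prod_expo (S : Finset (Fin k)) (ξ : Fin k → EuclideanSpace ℝ (Fin n))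
    (x : EuclideanSpace ℝ (Fin n)) : ∏ i ∈ S, expo (ξ i) x = expo (∑ i ∈ S, ξ i) x := by
  simp only [expo]
  rw [← Complex.exp_sum, sum_inner, Finset.mul_sum, ← Finset.sum_mul]
  push_cast
  rfl

lemma neg_norm_sq_sum_eq (S : Finset (Fin k)) (ξ : Fin k → EuclideanSpace ℝ (Fin n)) :
    ((-(4 * Real.pi ^ 2 * ‖∑ i ∈ S, ξ i‖ ^ 2) / 2 : ℝ) : ℂ) =
      (∑ i ∈ S, ∑ i' ∈ S, gramLabel ξ s(i, i')) / 2 := by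
  simp only [gramLabel_mk, ← real_inner_self_eq_norm_sq, sum_inner, inner_sum]
  push_cast
  simp only [Finset.mul_sum, Finset.sum_neg_distrib]
  rw [Finset.sum_comm]

-- The diagonal terms of the block exponents give the same prefactor for every `p`; each pair inside
-- a fibre contributes $e^{u_e}=1+(e^{u_e}-1)$, the shape required by the Mayer expansion.
open Classical in
lemma prod_integral_expo (hζ_indep : iIndepFun (fun (j : Fin n) (ω : Ω) => ζ ω j) P)
    (hζ_law : ∀ j : Fin n, HasLaw (fun ω => ζ ω j) (gaussianReal 0 1) P)
    (ξ : Fin k → EuclideanSpace ℝ (Fin n)) {d : ℕ} (p : Fin k → Fin d) :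
    ∏ j, ∫ ω, ∏ i with p i = j, expo (ξ i) (ζ ω) ∂P =
      Complex.exp ((∑ i, gramLabel ξ s(i, i)) / 2) *
        ∏ e ∈ nonDiag (Fin k),
          if (e.map p).IsDiag then 1 + (Complex.exp (gramLabel ξ e) - 1) else 1 := by
  simp only [prod_expo, integral_expo_gaussian hζ_indep hζ_law, neg_norm_sq_sum_eq]
  rw [← Complex.exp_sum]
  have h1 : ∑ j, (∑ i with p i = j, ∑ i' with p i' = j, gramLabel ξ s(i, i')) / 2 =
      (∑ i, ∑ i', if (Sym2.map p s(i, i')).IsDiag then gramLabel ξ s(i, i') else 0) / 2 := by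
    rw [← Finset.sum_div, ← Finset.sum_fiberwise _ p]
    congr 1
    refine Finset.sum_congr rfl fun j _ => Finset.sum_congr rfl fun i hi => ?_
    rw [Finset.sum_filter]
    refine Finset.sum_congr rfl fun i' _ => ?_
    simp [(Finset.mem_filter.1 hi).2, eq_comm]
  rw [h1, sum_sum_sym2 fun e => if (e.map p).IsDiag then gramLabel ξ e else 0, add_div,
    mul_div_cancel_left₀ _ two_ne_zero, Complex.exp_add, Complex.exp_sum]
  congr 1
  · simp
  · refine Finset.prod_congr rfl fun e _ => ?_
    split_ifs <;> simp

open Classical in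
lemma jointCumulant_expo (hk : 1 ≤ k) (hζ_indep : iIndepFun (fun (j : Fin n) (ω : Ω) => ζ ω j) P)
    (hζ_law : ∀ j : Fin n, HasLaw (fun ω => ζ ω j) (gaussianReal 0 1) P)
    (ξ : Fin k → EuclideanSpace ℝ (Fin n)) :
    jointCumulant P (fun i ω => expo (ξ i) (ζ ω)) =
      ∑ T : SpanningTree k, edgeProd (gramLabel ξ) T.1 *
        (Complex.exp ((∑ i, gramLabel ξ s(i, i)) / 2) *
          ∫ y : T.1.edgeSet → ℝ,
            Complex.exp (∑ e ∈ nonDiag (Fin k), gramLabel ξ e * sepMin T.1 (extendZero y) e)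
            ∂(Measure.pi fun _ => unif)) := by
  have : Nonempty (Fin k) := ⟨⟨0, hk⟩⟩
  have h := (sum_logCoeff_mul_prod_eq_sum_connected fun e =>
    Complex.exp (gramLabel ξ e) - 1).trans (sum_tree_integral_eq_sum_connected (gramLabel ξ)).symm
  have hp := fun (d : ℕ) (p : Fin k → Fin d) => prod_integral_expo hζ_indep hζ_law ξ p
  rw [jointCumulant_eq_sum]
  generalize Complex.exp ((∑ i, gramLabel ξ s(i, i)) / 2) = D at *
  refine Eq.trans (b := D * _) ?_ ((congrArg (D * ·) h).trans ?_)
  · rw [Finset.mul_sum, Fintype.card_fin]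
    refine Finset.sum_congr rfl fun d _ => ?_
    rw [mul_left_comm]
    refine congrArg (logCoeff d * ·) ?_
    rw [Finset.mul_sum]
    -- The two sums over surjections may carry different `Fintype` instances, which are equal by
    -- `Subsingleton.elim`.
    refine Finset.sum_congr (congrArg (@Finset.univ _) (Subsingleton.elim _ _)) fun p _ => ?_
    rw [hp]
  · rw [← Finset.sum_filter, Finset.sum_subtype _ (p := fun T => T.IsTree) (by simp), Finset.mul_sum]
    refine Finset.sum_congr rfl fun T _ => ?_
    rw [mul_left_comm]

variable {T : SimpleGraph (Fin k)} [Fintype T.edgeSet] {x : T.edgeSet → Ω → ℝ}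
  {wt : Ω → Matrix (Fin k) (Fin k) ℝ}

lemma integral_exp_sum_wt (hT : T.IsTree) (hx_indep : iIndepFun x P)
    (hx_law : ∀ e, HasLaw (x e) unif P)
    (hwt : ∀ᵐ ω ∂P, wt ω = weightMatrix T fun e => x e ω) (h : Sym2 (Fin k) → ℂ) :
    ∫ ω, Complex.exp (∑ i, ∑ j, h s(i, j) * wt ω i j / 2) ∂P =
      Complex.exp ((∑ i, h s(i, i)) / 2) *
        ∫ y : T.edgeSet → ℝ, Complex.exp (∑ e ∈ nonDiag (Fin k), h e * sepMin T (extendZero y) e)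
          ∂(Measure.pi fun _ => unif) := by
  have hm : Measurable fun y : T.edgeSet → ℝ =>
      Complex.exp (∑ e ∈ nonDiag (Fin k), h e * sepMin T (extendZero y) e) := by
    refine Complex.measurable_exp.comp (Finset.measurable_fun_sum _ fun e _ => ?_)
    refine measurable_const.mul (Complex.measurable_ofReal.comp ?_)
    exact (measurable_sepMin T e).comp measurable_extendZero
  rw [← map_eq_pi hx_indep hx_law, integral_map (aemeasurable_pi_of_hasLaw hx_law)
    hm.aestronglyMeasurable, ← integral_const_mul]
  refine integral_congr_ae ?_
  filter_upwards [ae_wt_eq hT hx_indep hx_law hwt] with ω hω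
  have hd := (isCoUltrametric_sepMatrix hT (extendZero_pos hω.1)).diag
  rw [← Complex.exp_add]
  congr 1
  simp only [hω.2, sepMatrix, ← Finset.sum_div] at hd ⊢
  rw [sum_sum_sym2 fun e => h e * sepMin T (extendZero fun e => x e ω) e, add_div,
    mul_div_cancel_left₀ _ two_ne_zero]
  simp [hd]

end CumulantOfExponentials

end TreeCumulant

/-! ### Both sides as combinations of row integrals, and the conclusion. -/

namespace TreeCumulant

variable {Ω : Type*} [MeasurableSpace Ω] {P : Measure Ω} {k n : ℕ}

lemma integrable_and_integral_eq_sum_rowIntegral {Y : Ω → Matrix (Fin k) (Fin n) ℝ}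
    (hY : AEMeasurable (fun ω => rows (Y ω)) P)
    (hμ : ∀ C : ℝ, Integrable (fun y => Real.exp (C * ∑ i, ‖y i‖)) (P.map fun ω => rows (Y ω)))
    {ι : Type*} [Fintype ι] (a : ι → Fin k → List (Fin n))
    {f : Fin k → EuclideanSpace ℝ (Fin n) → ℂ} (hf : ∀ i, Tame (f i))
    {F : Matrix (Fin k) (Fin n) ℝ → ℂ}
    (hF : F = fun x => ∑ c, tensorProd (fun i => pd (a c i) (f i)) x) :
    Integrable (fun ω => F (Y ω)) P ∧
      ∫ ω, F (Y ω) ∂P = ∑ c, rowIntegral (P.map fun ω => rows (Y ω)) (a c) f := by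
  have hi : ∀ c, Integrable (fun ω => tensorProd (fun i => pd (a c i) (f i)) (Y ω)) P := fun c =>
    (integrable_prod_pd hμ hf (a c)).comp_aemeasurable hY
  rw [hF]
  refine ⟨integrable_finsetSum _ fun c _ => hi c, ?_⟩
  rw [integral_finsetSum _ fun c _ => hi c]
  refine Finset.sum_congr rfl fun c _ => ?_
  rw [rowIntegral, integral_map hY (continuous_prod_pd hf (a c)).aestronglyMeasurable]
  rfl

lemma Tame.continuous {f : EuclideanSpace ℝ (Fin n) → ℂ} (hf : Tame f) : Continuous f :=
  hf.smooth.continuous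

lemma jointCumulant_eq_sum_rowIntegral [IsProbabilityMeasure P] {ζ : Ω → EuclideanSpace ℝ (Fin n)}
    (hζ : AEMeasurable ζ P) {f : Fin k → EuclideanSpace ℝ (Fin n) → ℂ} (hf : ∀ i, Continuous (f i)) :
    jointCumulant P (fun i ω => f i (ζ ω)) =
      ∑ q : Σ d : Fin (k + 1), {p : Fin k → Fin d // Function.Surjective p},
        logCoeff q.1 * rowIntegral (blockMeasure q.2.1 (P.map ζ)) (fun _ => []) f := by
  have := Measure.isProbabilityMeasure_map hζ (μ := P)
  rw [jointCumulant_eq_sum, Finset.sum_range, Fintype.sum_sigma]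
  refine Finset.sum_congr rfl fun d _ => ?_
  rw [Finset.mul_sum]
  refine Finset.sum_congr (congrArg (@Finset.univ _) (Subsingleton.elim _ _)) fun p _ => ?_
  rw [rowIntegral_blockMeasure _ _ hf]
  congr 1
  refine Finset.prod_congr rfl fun j _ => ?_
  rw [integral_map hζ (continuous_finsetProd _ fun i _ => hf i).aestronglyMeasurable]

lemma Tame.integrable_norm_pow {f : EuclideanSpace ℝ (Fin n) → ℂ} (hf : Tame f)
    {ζ : Ω → EuclideanSpace ℝ (Fin n)} (hζ : AEMeasurable ζ P)
    (hexp : ∀ K : ℝ, Integrable (fun ω => Real.exp (K * ‖ζ ω‖)) P) (m : ℕ) :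
    Integrable (fun ω => ‖f (ζ ω)‖ ^ m) P := by
  obtain ⟨C, c, -, -, hb⟩ := (hf.expGrowth_pd []).exists_nonneg
  refine ((hexp (m * c)).const_mul (C ^ m)).mono'
    ((hf.continuous.norm.pow m).measurable.comp_aemeasurable hζ).aestronglyMeasurable
    (Filter.Eventually.of_forall fun ω => ?_)
  rw [norm_pow, norm_norm, mul_assoc, Real.exp_nat_mul, ← mul_pow]
  exact pow_le_pow_left₀ (norm_nonneg _) (hb _) m

end TreeCumulant

open TreeCumulant in
theorem mainTheorem2
    {Ω : Type*} [MeasurableSpace Ω] (P : Measure Ω) [IsProbabilityMeasure P]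
    (k n : ℕ) (hk : 1 ≤ k)
    -- `ζ` and `Z` have i.i.d. standard Gaussian entries
    (ζ : Ω → EuclideanSpace ℝ (Fin n))
    (hζ_indep : iIndepFun (fun (j : Fin n) (ω : Ω) => ζ ω j) P)
    (hζ_law : ∀ j : Fin n, HasLaw (fun ω => ζ ω j) (gaussianReal 0 1) P)
    (Z : Ω → Matrix (Fin k) (Fin n) ℝ)
    (hZ_indep : iIndepFun (fun (p : Fin k × Fin n) (ω : Ω) => Z ω p.1 p.2) P)
    (hZ_law : ∀ (i : Fin k) (j : Fin n), HasLaw (fun ω => Z ω i j) (gaussianReal 0 1) P)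
    -- for each spanning tree, i.i.d. edge labels uniformly distributed in `(0, 1)`
    (x : (T : TreeCumulant.SpanningTree k) → T.1.edgeSet → Ω → ℝ)
    (hx_indep : ∀ T : TreeCumulant.SpanningTree k, iIndepFun (x T) P)
    (hx_law : ∀ (T : TreeCumulant.SpanningTree k) (e : T.1.edgeSet),
      HasLaw (x T e) (volume.restrict (Set.Ioo (0 : ℝ) 1)) P)
    -- the random weight matrices
    (wt : TreeCumulant.SpanningTree k → Ω → Matrix (Fin k) (Fin k) ℝ)
    (hwt : ∀ T : TreeCumulant.SpanningTree k, ∀ᵐ ω ∂P,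
      wt T ω = TreeCumulant.weightMatrix T.1 (fun e => x T e ω))
    (hwtZ : ∀ T : TreeCumulant.SpanningTree k, IndepFun (wt T) Z P)
    (f : Fin k → EuclideanSpace ℝ (Fin n) → ℂ) (hf : ∀ i, TreeCumulant.Tame (f i)) :
    -- the expectations in the formula exist
    (∀ (i : Fin k) (m : ℕ), Integrable (fun ω => ‖f i (ζ ω)‖ ^ m) P) ∧
    (∀ T : TreeCumulant.SpanningTree k,
      Integrable (fun ω => TreeCumulant.treeOp T.1 (TreeCumulant.tensorProd f)
        (TreeCumulant.matrixSqrt (wt T ω) * Z ω)) P) ∧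
    TreeCumulant.jointCumulant P (fun i ω => f i (ζ ω)) =
      ∑ T : TreeCumulant.SpanningTree k,
        ∫ ω, TreeCumulant.treeOp T.1 (TreeCumulant.tensorProd f)
          (TreeCumulant.matrixSqrt (wt T ω) * Z ω) ∂P := by
  classical
  have hZ_law' : ∀ p : Fin k × Fin n, HasLaw (fun ω => Z ω p.1 p.2) (gaussianReal 0 1) P :=
    fun p => hZ_law p.1 p.2
  have hζ := aemeasurable_of_coords hζ_law
  have hZ := aemeasurable_matrix hZ_law'
  have hexp := integrable_exp_norm_gaussian hζ_indep hζ_law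
  have hw := fun T : SpanningTree k => aemeasurable_wt T.2 (hx_indep T) (hx_law T) (hwt T)
  have hpsd := fun T : SpanningTree k => ae_wt_posSemidef T.2 (hx_indep T) (hx_law T) (hwt T)
  have hY := fun T : SpanningTree k => aemeasurable_sqrt_mul (hw T) hZ
  have hYexp := fun T : SpanningTree k => integrable_exp_rows (hw T) (hpsd T) hZ_indep hZ_law'
  choose ι hι a ha using fun T : SpanningTree k => exists_foldr_edgeOp_eq_sum (n := n)
    T.1.edgeSet.toFinite.toFinset.toList
  have htree := fun (T : SpanningTree k) (g : Fin k → EuclideanSpace ℝ (Fin n) → ℂ)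
    (hg : ∀ i, Tame (g i)) => integrable_and_integral_eq_sum_rowIntegral (hY T) (hYexp T) (a T) hg
      (ha T g fun i => (hg i).smooth)
  refine ⟨fun i m => (hf i).integrable_norm_pow hζ hexp m, fun T => (htree T f hf).1, ?_⟩
  -- The difference of the two sides becomes one linear combination of row integrals: block laws
  -- with logarithmic coefficients on the left summand, the terms of $L_T$ with coefficient $-1$ on
  -- the right one. The coefficients, laws and multi-indices do not depend on the functions.
  let I := (Σ d : Fin (k + 1), {p : Fin k → Fin d // Function.Surjective p}) ⊕
    (Σ T : SpanningTree k, ι T)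
  let c : I → ℂ := Sum.elim (fun q => logCoeff q.1) fun _ => -1
  let μ : I → Measure (Fin k → EuclideanSpace ℝ (Fin n)) := Sum.elim
    (fun q => blockMeasure q.2.1 (P.map ζ))
    fun q => P.map fun ω => rows (matrixSqrt (wt q.1 ω) * Z ω)
  let b : I → Fin k → List (Fin n) := Sum.elim (fun _ _ => []) fun q => a q.1 q.2
  have key : ∀ g : Fin k → EuclideanSpace ℝ (Fin n) → ℂ, (∀ i, Tame (g i)) →
      jointCumulant P (fun i ω => g i (ζ ω)) - ∑ T : SpanningTree k,
        ∫ ω, treeOp T.1 (tensorProd g) (matrixSqrt (wt T ω) * Z ω) ∂P =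
      ∑ τ, c τ * rowIntegral (μ τ) (b τ) g := by
    intro g hg
    rw [jointCumulant_eq_sum_rowIntegral hζ fun i => (hg i).continuous, Fintype.sum_sum_type,
      sub_eq_add_neg, Fintype.sum_sigma (α := ι), ← Finset.sum_neg_distrib]
    congr 1
    refine Finset.sum_congr rfl fun T _ => ?_
    refine (congrArg Neg.neg (htree T g hg).2).trans ?_
    rw [← Finset.sum_neg_distrib]
    exact Finset.sum_congr rfl fun _ _ => (neg_one_mul _).symm
  have : IsProbabilityMeasure (P.map ζ) := Measure.isProbabilityMeasure_map hζ
  have hμ : ∀ τ, IsProbabilityMeasure (μ τ) := by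
    rintro (q | q)
    · exact inferInstanceAs (IsProbabilityMeasure (blockMeasure q.2.1 (P.map ζ)))
    · exact Measure.isProbabilityMeasure_map (hY q.1)
  have hμexp : ∀ τ (C : ℝ), Integrable (fun y => Real.exp (C * ∑ i, ‖y i‖)) (μ τ) := by
    rintro (q | q) C
    · refine integrable_exp_blockMeasure q.2.1 (fun K => ?_) C
      rw [integrable_map_measure (by fun_prop) hζ]
      exact hexp K
    · exact hYexp q.1 C
  -- It remains to verify the relation on characters. These are tame, so `key` turns it back into
  -- the identity of the theorem for them.
  refine sub_eq_zero.1 ((key f hf).trans (sum_rowIntegral_tame_eq_zero c μ hμexp b (fun ξ => ?_) hf))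
  rw [← key _ fun i => tame_expo (ξ i), sub_eq_zero, jointCumulant_expo hk hζ_indep hζ_law]
  refine Finset.sum_congr rfl fun T _ => ?_
  rw [← integral_exp_sum_wt T.2 (hx_indep T) (hx_law T) (hwt T),
    ← integral_tensorProd_expo (hw T) (hpsd T) hZ_indep hZ_law' (hwtZ T) ξ, treeOp_expo,
    integral_const_mul]
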